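/- All schemes are over $\mathbb C$, a smooth variety is a smooth separated scheme of finite type over $\mathbb C$, and for $n\ge 1$ we put $Z_n=\operatorname{Spec}\,\mathbb C[t]/(t^n)$; the equation $t=0$ defines a closed immersion $U\hookrightarrow U\times Z_n$ for every scheme $U$. **(A)** Let $X$ be an irreducible smooth variety and $Y\subset X$ a smooth hypersurface, i.e. a closed subscheme, smooth over $\mathbb C$, whose ideal sheaf $\mathcal I_Y$ is locally generated by one nonzerodivisor. For $n\ge 1$ let $Y_n\subset X$ be the closed subscheme with ideal sheaf $\mathcal I_Y^n$, and for $P\in Y$ let $\mathcal O_{n,P}$ and $\mathcal O_{Y,P}$ be the local rings of $Y_n$ and $Y$ at $P$. Then for every $n\ge1$ and every $P\in Y$: 1. The restriction $r:\mathcal O_{n,P}\to\mathcal O_{Y,P}$ has a section $\sigma:\mathcal O_{Y,P}\to\mathcal O_{n,P}$ which is a homomorphism of $\mathbb C$-algebras. 2. For every such section $\sigma$ there is an isomorphism of $\mathbb C$-algebras $e:\mathcal O_{Y,P}\otimes_{\mathbb C}\mathbb C[t]/(t^n)\simeq\mathcal O_{n,P}$ with $e(a\otimes 1)=\sigma(a)$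 for all $a$, and $r(e(1\otimes t))=0$. 3. There are an open neighbourhood $U$ of $P$ in $Y$ and, if $U_n$ denotes the corresponding open subscheme of $Y_n$, an isomorphism of $\mathbb C$-schemes $U_n\simeq U\times Z_n$ whose composite with the inclusion $U\hookrightarrow U_n$ is the inclusion $U\hookrightarrow U\times Z_n$. **(B)** Let $X$ be a connected smooth variety of dimension $3$ and $Y\subset X$ a primitive multiple curve, i.e. a Cohen–Macaulay closed subscheme such that $C=Y_{\mathrm{red}}$ is a smooth connected curve and such that for every closed point $x$ of $C$ there is a surface $S\subset X$, smooth at $x$, containing a neighbourhood of $x$ in $Y$. Then there is a smallest integer $n$ with $\mathcal I_C^n\subset\mathcal I_Y$ (the multiplicity of $Y$), $n\ge 1$, and $Y$ is an abstract primitive multiple curve of multiplicity $n$ with reduced curve $C$: there are an open cover $(U_i)$ of $C$ and, for all $i,j$, an automorphism $g_{ij}$ of the $\mathbb C$-scheme $(U_i\cap U_j)\times Z_n$ inducing the identity on $U_i\cap U_j$, with $g_{jk}\circ g_{ij}=g_{ik}$ on $(U_i\cap U_j\cap U_k)\times Z_n$ for all $i,j,k$, and an isomorphism of $\mathbb C$-schemes,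 inducing the identity on $C$, from $Y$ to the scheme obtained by gluing the $U_i\times Z_n$ along the $g_{ij}$. -/

import Mathlib

open CategoryTheory CategoryTheory.Limits AlgebraicGeometry
open scoped Polynomial TensorProduct

noncomputable section

namespace PrimitiveCurves

/-! ### The base `Spec ℂ` and the fat points `Z_n = Spec ℂ[t]/(t^n)` -/

/-- The scheme `Spec ℂ`. -/
abbrev SpecC : Scheme.{0} := Spec (.of ℂ)

/-- The `ℂ`-algebra `ℂ[t]/(t^n)`. -/
abbrev TruncPoly (n : ℕ) : Type := ℂ[X] ⧸ Ideal.span {(Polynomial.X : ℂ[X]) ^ n}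

/-- The class of `t` in `ℂ[t]/(t^n)`. -/
def TruncPoly.t (n : ℕ) : TruncPoly n := Ideal.Quotient.mk _ Polynomial.X

/-- Evaluation at `t = 0`, as a ring homomorphism `ℂ[t]/(t^n) → ℂ` (for `n ≥ 1`). -/
def TruncPoly.evalZero (n : ℕ) [NeZero n] : TruncPoly n →+* ℂ :=
  Ideal.Quotient.lift _ (Polynomial.evalRingHom (0 : ℂ)) (by
    intro a ha
    obtain ⟨b, rfl⟩ := Ideal.mem_span_singleton.mp ha
    simp [NeZero.ne n])

/-- The fat point `Z_n = Spec ℂ[t]/(t^n)`. -/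
abbrev Z (n : ℕ) : Scheme.{0} := Spec (.of (TruncPoly n))

/-- The structure morphism `Z_n → Spec ℂ`. -/
def Z.str (n : ℕ) : Z n ⟶ SpecC :=
  Spec.map (CommRingCat.ofHom (algebraMap ℂ (TruncPoly n)))

/-- The closed point `Spec ℂ → Z_n`, given by `t = 0`. -/
def Z.zero (n : ℕ) [NeZero n] : SpecC ⟶ Z n :=
  Spec.map (CommRingCat.ofHom (TruncPoly.evalZero n))

lemma Z.zero_str (n : ℕ) [NeZero n] : Z.zero n ≫ Z.str n = 𝟙 _ := by
  unfold Z.zero Z.str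
  rw [← Spec.map_comp, ← CommRingCat.ofHom_comp, ← Spec.map_id]
  congr 1
  ext z
  change TruncPoly.evalZero n (algebraMap ℂ (TruncPoly n) z) = z
  change Polynomial.eval 0 (Polynomial.C z) = z
  simp

instance (n : ℕ) [NeZero n] : Surjective (Z.zero n) := by
  refine ⟨?_⟩
  have hs : Function.Surjective (TruncPoly.evalZero n) := fun z =>
    ⟨algebraMap ℂ (TruncPoly n) z, by
      change Polynomial.eval 0 (Polynomial.C z) = z
      simp⟩
  have hr := range_comap_of_surjective _ (TruncPoly.evalZero n) hs
  have hk : (RingHom.ker (TruncPoly.evalZero n) : Set (TruncPoly n)) ⊆ nilradical (TruncPoly n) := by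
    intro a ha
    obtain ⟨q, rfl⟩ := Ideal.Quotient.mk_surjective a
    have h0 : Polynomial.eval 0 q = 0 := ha
    obtain ⟨r, rfl⟩ : (Polynomial.X : ℂ[X]) ∣ q := by
      rw [Polynomial.X_dvd_iff, Polynomial.coeff_zero_eq_eval_zero, h0]
    refine mem_nilradical.mpr ⟨n, ?_⟩
    rw [← map_pow, Ideal.Quotient.eq_zero_iff_mem, mul_pow]
    exact Ideal.mul_mem_right _ _ (Ideal.mem_span_singleton_self _)
  rw [← Set.range_eq_univ]
  refine hr.trans ?_
  refine Set.eq_univ_of_forall fun p a ha => ?_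
  exact nilradical_le_prime p.asIdeal (hk ha)

/-! ### The product `C × Z_n` -/

section Product

variable {C : Scheme.{0}} (π : C ⟶ SpecC) (n : ℕ)

/-- The product `C × Z_n` over `Spec ℂ`. -/
abbrev prodZ : Scheme.{0} := pullback π (Z.str n)

/-- The projection `C × Z_n → C`. -/
abbrev prodZ.fst : prodZ π n ⟶ C := pullback.fst π (Z.str n)

/-- The structure morphism `C × Z_n → Spec ℂ`. -/
abbrev prodZ.str : prodZ π n ⟶ SpecC := prodZ.fst π n ≫ π

/-- The canonical closed immersion `C → C × Z_n`, given by `t = 0`. -/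
def prodZ.zero [NeZero n] : C ⟶ prodZ π n :=
  pullback.lift (𝟙 C) (π ≫ Z.zero n) (by simp [Z.zero_str])

lemma prodZ.isPullback_zero [NeZero n] :
    IsPullback (prodZ.zero π n) π (pullback.snd π (Z.str n)) (Z.zero n) := by
  refine IsPullback.of_right (h₁₂ := prodZ.fst π n) (h₂₂ := Z.str n) (v₁₃ := π) ?_ ?_
    (IsPullback.of_hasPullback π (Z.str n))
  · simp only [prodZ.zero, pullback.lift_fst, Z.zero_str]
    exact IsPullback.of_horiz_isIso ⟨by simp⟩
  · exact pullback.lift_snd _ _ _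

instance [NeZero n] : Surjective (prodZ.zero π n) :=
  MorphismProperty.of_isPullback (prodZ.isPullback_zero π n).flip inferInstance

/-- The open subscheme `U × Z_n` of `C × Z_n`, for `U` open in `C`. -/
abbrev prodZ.over (U : C.Opens) : Scheme.{0} := ((prodZ.fst π n) ⁻¹ᵁ U).toScheme

/-- The open immersion `W × Z_n → U × Z_n` for `W ⊆ U`. -/
abbrev prodZ.incl {W U : C.Opens} (h : W ≤ U) : prodZ.over π n W ⟶ prodZ.over π n U :=
  (prodZ π n).homOfLE (Scheme.Hom.preimage_mono _ h)

/-- The canonical closed immersion `U → U × Z_n`, given by `t = 0` (the source is `U`, written as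
the preimage of `U × Z_n` in `C`). -/
abbrev prodZ.zeroOn [NeZero n] (U : C.Opens) :
    ((prodZ.zero π n) ⁻¹ᵁ ((prodZ.fst π n) ⁻¹ᵁ U)).toScheme ⟶ prodZ.over π n U :=
  (prodZ.zero π n) ∣_ ((prodZ.fst π n) ⁻¹ᵁ U)

/-! ### The sheaf `𝒢_n` of automorphisms of `C × Z_n` inducing the identity on `C` -/

/-- The elements of `𝒢_n(U)`: automorphisms of the `ℂ`-scheme `U × Z_n` which induce the identity
on the closed subscheme `U`. -/
structure G [NeZero n] (U : C.Opens) where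
  /-- the underlying automorphism -/
  iso : prodZ.over π n U ≅ prodZ.over π n U
  over_base : iso.hom ≫ ((prodZ.fst π n) ⁻¹ᵁ U).ι ≫ prodZ.str π n =
    ((prodZ.fst π n) ⁻¹ᵁ U).ι ≫ prodZ.str π n
  fix_zero : prodZ.zeroOn π n U ≫ iso.hom = prodZ.zeroOn π n U

variable {π n} [NeZero n]

lemma G.apply {U : C.Opens} (g : G π n U) (x : prodZ.over π n U) : g.iso.hom x = x := by
  have : Surjective (prodZ.zeroOn π n U) :=
    IsZariskiLocalAtTarget.restrict (P := @Surjective) inferInstance _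
  obtain ⟨c, rfl⟩ := (prodZ.zeroOn π n U).surjective x
  rw [← Scheme.Hom.comp_apply, g.fix_zero]

lemma G.range_subset {W U : C.Opens} (g : G π n U) (h : W ≤ U) :
    Set.range (prodZ.incl π n h ≫ g.iso.hom) ⊆ Set.range (prodZ.incl π n h) := by
  rintro _ ⟨x, rfl⟩
  exact ⟨x, by rw [Scheme.Hom.comp_apply, g.apply]⟩

/-- The restriction of an element of `𝒢_n(U)` to `W × Z_n`, for `W ⊆ U`. -/
def G.res {W U : C.Opens} (g : G π n U) (h : W ≤ U) : prodZ.over π n W ⟶ prodZ.over π n W :=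
  IsOpenImmersion.lift (prodZ.incl π n h) (prodZ.incl π n h ≫ g.iso.hom) (g.range_subset h)

lemma G.res_incl {W U : C.Opens} (g : G π n U) (h : W ≤ U) :
    g.res h ≫ prodZ.incl π n h = prodZ.incl π n h ≫ g.iso.hom :=
  IsOpenImmersion.lift_fac _ _ _

lemma G.res_res {V W U : C.Opens} (g : G π n U) (h : W ≤ U) (h' : V ≤ W) :
    g.res (h'.trans h) ≫ prodZ.incl π n h' = prodZ.incl π n h' ≫ g.res h := by
  rw [← cancel_mono (prodZ.incl π n h), Category.assoc, Category.assoc, g.res_incl,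
    Scheme.homOfLE_homOfLE, Scheme.homOfLE_homOfLE_assoc, ← g.res_incl]

end Product

/-! ### Abstract primitive multiple curves -/

/-- A 1-cocycle with values in `𝒢_n` for an open cover `(U_i)` of `C`. -/
structure Cocycle {C : Scheme.{0}} (π : C ⟶ SpecC) (n : ℕ) [NeZero n] where
  /-- the indices of the cover -/
  J : Type
  /-- the members of the cover -/
  U : J → C.Opens
  iSup_U : ⨆ i, U i = ⊤
  /-- the automorphisms of the `(U_i ∩ U_j) × Z_n` -/
  g : ∀ i j, G π n (U i ⊓ U j)
  cocycle : ∀ i j k,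
    (g i j).res (W := U i ⊓ U j ⊓ U k) inf_le_left ≫
      (g j k).res (le_inf (inf_le_left.trans inf_le_right) inf_le_right) =
    (g i k).res (le_inf (inf_le_left.trans inf_le_left) inf_le_right)

namespace Cocycle

variable {C : Scheme.{0}} {π : C ⟶ SpecC} {n : ℕ} [NeZero n] (c : Cocycle π n)

lemma cocycle_res (i j k : c.J) (W : C.Opens) (hij : W ≤ c.U i ⊓ c.U j) (hjk : W ≤ c.U j ⊓ c.U k)
    (hik : W ≤ c.U i ⊓ c.U k) :
    (c.g i j).res hij ≫ (c.g j k).res hjk = (c.g i k).res hik := by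
  have hW : W ≤ c.U i ⊓ c.U j ⊓ c.U k := le_inf hij (hjk.trans inf_le_right)
  have h1 : c.U i ⊓ c.U j ⊓ c.U k ≤ c.U j ⊓ c.U k :=
    le_inf (inf_le_left.trans inf_le_right) inf_le_right
  have h2 : c.U i ⊓ c.U j ⊓ c.U k ≤ c.U i ⊓ c.U k :=
    le_inf (inf_le_left.trans inf_le_left) inf_le_right
  rw [← cancel_mono (prodZ.incl π n hW), Category.assoc, (c.g j k).res_res h1 hW,
    reassoc_of% ((c.g i j).res_res inf_le_left hW), c.cocycle, ← (c.g i k).res_res h2 hW]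

lemma g_self (i : c.J) : (c.g i i).iso.hom = 𝟙 _ := by
  have h := c.cocycle_res i i i _ le_rfl le_rfl le_rfl
  have h1 : (c.g i i).res le_rfl = (c.g i i).iso.hom := by
    have := (c.g i i).res_incl le_rfl
    simpa only [prodZ.incl, Scheme.homOfLE_rfl, Category.comp_id, Category.id_comp] using this
  rw [h1] at h
  rw [← cancel_epi (c.g i i).iso.hom, h, Category.comp_id]

lemma g_self_res (i : c.J) {W : C.Opens} (h : W ≤ c.U i ⊓ c.U i) : (c.g i i).res h = 𝟙 _ := by
  rw [← cancel_mono (prodZ.incl π n h), G.res_incl, g_self, Category.comp_id, Category.id_comp]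

lemma isPullback_incl (i j k : c.J) :
    IsPullback
      (prodZ.incl π n (inf_le_left : c.U i ⊓ c.U j ⊓ c.U k ≤ c.U i ⊓ c.U j))
      (prodZ.incl π n (le_inf (inf_le_left.trans inf_le_left) inf_le_right :
        c.U i ⊓ c.U j ⊓ c.U k ≤ c.U i ⊓ c.U k))
      (prodZ.incl π n inf_le_left) (prodZ.incl π n inf_le_left) := by
  have h := isPullback_opens_inf_le (X := prodZ π n)
    (Scheme.Hom.preimage_mono (prodZ.fst π n) (inf_le_left : c.U i ⊓ c.U j ≤ c.U i))
    (Scheme.Hom.preimage_mono (prodZ.fst π n) (inf_le_left : c.U i ⊓ c.U k ≤ c.U i))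
  refine h.of_iso (Scheme.isoOfEq _ ?_) (Iso.refl _) (Iso.refl _) (Iso.refl _) ?_ ?_ ?_ ?_
  · rw [← Scheme.Hom.preimage_inf]
    congr 1
    apply le_antisymm
    · exact le_inf inf_le_left (inf_le_right.trans inf_le_right)
    · exact le_inf inf_le_left (le_inf (inf_le_left.trans inf_le_left) inf_le_right)
  all_goals { simp [← cancel_mono (Scheme.Opens.ι _)] }

/-- The triple overlap `(U_i ∩ U_j ∩ U_k) × Z_n` as a fibre product. -/
def tripleIso (i j k : c.J) :
    pullback (prodZ.incl π n (inf_le_left : c.U i ⊓ c.U j ≤ c.U i))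
      (prodZ.incl π n (inf_le_left : c.U i ⊓ c.U k ≤ c.U i)) ≅
    prodZ.over π n (c.U i ⊓ c.U j ⊓ c.U k) :=
  (c.isPullback_incl i j k).isoPullback.symm

lemma rotate_le (i j k : c.J) : c.U i ⊓ c.U j ⊓ c.U k ≤ c.U j ⊓ c.U k ⊓ c.U i :=
  le_inf (le_inf (inf_le_left.trans inf_le_right) inf_le_right) (inf_le_left.trans inf_le_left)

lemma tripleIso_hom_incl (i j k : c.J) :
    (c.tripleIso i j k).hom ≫ prodZ.incl π n inf_le_left = pullback.fst _ _ :=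
  (c.isPullback_incl i j k).isoPullback_inv_fst

lemma tripleIso_inv_snd (i j k : c.J) :
    (c.tripleIso i j k).inv ≫ pullback.snd _ _ =
      prodZ.incl π n (le_inf (inf_le_left.trans inf_le_left) inf_le_right) :=
  (c.isPullback_incl i j k).isoPullback_hom_snd

/-- The gluing data with pieces `U_i × Z_n`, overlaps `(U_i ∩ U_j) × Z_n` and transition maps the
`g_ij`. -/
def glueData : Scheme.GlueData.{0} where
  J := c.J
  U i := prodZ.over π n (c.U i)
  V ij := prodZ.over π n (c.U ij.1 ⊓ c.U ij.2)
  f i j := prodZ.incl π n inf_le_left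
  f_open i j := inferInstance
  f_id i := by
    refine ⟨prodZ.incl π n (le_inf le_rfl le_rfl), ?_, ?_⟩ <;> simp
  t i j := (c.g i j).iso.hom ≫ prodZ.incl π n (le_of_eq (inf_comm _ _))
  t_id i := by simp [g_self]
  t' i j k := (c.tripleIso i j k).hom ≫ (c.g i j).res inf_le_left ≫
    prodZ.incl π n (c.rotate_le i j k) ≫ (c.tripleIso j k i).inv
  t_fac i j k := by
    simp only [Category.assoc, tripleIso_inv_snd, ← c.tripleIso_hom_incl i j k,
      Scheme.homOfLE_homOfLE]
    rw [← reassoc_of% ((c.g i j).res_incl), Scheme.homOfLE_homOfLE]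
  cocycle i j k := by
    have h1 : c.U i ⊓ c.U j ⊓ c.U k ≤ c.U j ⊓ c.U k :=
      le_inf (inf_le_left.trans inf_le_right) inf_le_right
    have h2 : c.U i ⊓ c.U j ⊓ c.U k ≤ c.U i ⊓ c.U k :=
      le_inf (inf_le_left.trans inf_le_left) inf_le_right
    have h3 : c.U i ⊓ c.U j ⊓ c.U k ≤ c.U k ⊓ c.U i :=
      le_inf inf_le_right (inf_le_left.trans inf_le_left)
    have h4 : c.U i ⊓ c.U j ⊓ c.U k ≤ c.U i ⊓ c.U i :=
      le_inf (inf_le_left.trans inf_le_left) (inf_le_left.trans inf_le_left)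
    have h5 : c.U i ⊓ c.U j ⊓ c.U k ≤ c.U k ⊓ c.U i ⊓ c.U j :=
      (c.rotate_le i j k).trans (c.rotate_le j k i)
    simp only [Category.assoc, Iso.inv_hom_id_assoc]
    rw [← reassoc_of% ((c.g j k).res_res inf_le_left (c.rotate_le i j k)), Scheme.homOfLE_homOfLE_assoc,
      ← reassoc_of% ((c.g k i).res_res inf_le_left h5), Scheme.homOfLE_homOfLE_assoc,
      Scheme.homOfLE_rfl, Category.id_comp]
    have e1 := c.cocycle_res i j k _ inf_le_left h1 h2
    have e2 := c.cocycle_res i k i _ h2 h3 h4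
    rw [g_self_res] at e2
    rw [reassoc_of% e1, reassoc_of% e2, Iso.hom_inv_id]

/-- The scheme `C(g)` obtained by gluing the `U_i × Z_n` along the `g_ij`: the abstract primitive
multiple curve of multiplicity `n` defined by the cocycle. -/
def glued : Scheme.{0} := c.glueData.glued

/-- The open immersion `U_i × Z_n → C(g)`. -/
def chart (i : c.J) : prodZ.over π n (c.U i) ⟶ c.glued := c.glueData.ι i

lemma str_compat (i j : c.J) :
    prodZ.incl π n (inf_le_left : c.U i ⊓ c.U j ≤ c.U i) ≫
      ((prodZ.fst π n) ⁻¹ᵁ (c.U i)).ι ≫ prodZ.str π n =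
    ((c.g i j).iso.hom ≫ prodZ.incl π n (le_of_eq (inf_comm (c.U i) (c.U j)))) ≫
      prodZ.incl π n (inf_le_left : c.U j ⊓ c.U i ≤ c.U j) ≫
      ((prodZ.fst π n) ⁻¹ᵁ (c.U j)).ι ≫ prodZ.str π n := by
  rw [Category.assoc, Scheme.homOfLE_homOfLE_assoc, Scheme.homOfLE_ι_assoc,
    Scheme.homOfLE_ι_assoc, (c.g i j).over_base]

/-- The structure morphism `C(g) → Spec ℂ`. -/
def str : c.glued ⟶ SpecC :=
  Multicoequalizer.desc c.glueData.diagram _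
    (fun i => ((prodZ.fst π n) ⁻¹ᵁ (c.U i)).ι ≫ prodZ.str π n)
    (fun ij => c.str_compat ij.1 ij.2)

lemma chart_str (i : c.J) :
    c.chart i ≫ c.str = ((prodZ.fst π n) ⁻¹ᵁ (c.U i)).ι ≫ prodZ.str π n :=
  Multicoequalizer.π_desc _ _ _ _ _

end Cocycle

/-- For a closed immersion `j : C → Y` of `ℂ`-schemes: `Y` is an abstract primitive multiple curve
of multiplicity `n` with associated reduced curve `C`, i.e. there is an isomorphism of `ℂ`-schemes
`C(g) ≅ Y` inducing the identity on `C`, for some 1-cocycle `g` with values in `𝒢_n`. -/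
def IsAbstractPrimitiveCurve {C Y : Scheme.{0}} (ρ : Y ⟶ SpecC) (j : C ⟶ Y) (n : ℕ)
    [NeZero n] : Prop :=
  ∃ (c : Cocycle (j ≫ ρ) n) (e : c.glued ≅ Y),
    e.hom ≫ ρ = c.str ∧
    ∀ i, prodZ.zeroOn (j ≫ ρ) n (c.U i) ≫ c.chart i ≫ e.hom = Scheme.Opens.ι _ ≫ j

/-! ### Local rings as `ℂ`-algebras -/

/-- The local ring `𝒪_{X,x}` of a `ℂ`-scheme `π : X → Spec ℂ`. -/
def LocalRingAt {X : Scheme.{0}} (_π : X ⟶ SpecC) (x : X) : Type := X.presheaf.stalk x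

namespace LocalRingAt

variable {X Y : Scheme.{0}} (π : X ⟶ SpecC)

instance (x : X) : CommRing (LocalRingAt π x) :=
  inferInstanceAs (CommRing (X.presheaf.stalk x))

/-- The `ℂ`-algebra structure of `𝒪_{X,x}`, induced by `π`. -/
instance (x : X) : Algebra ℂ (LocalRingAt π x) :=
  RingHom.toAlgebra (R := ℂ) (S := X.presheaf.stalk x)
    ((Scheme.ΓSpecIso (.of ℂ)).inv ≫ π.appTop ≫ X.presheaf.germ ⊤ x (TopologicalSpace.Opens.mem_top x)).hom

/-- The homomorphism of `ℂ`-algebras `𝒪_{X,f(y)} → 𝒪_{Y,y}` induced by a morphism `f : Y → X` of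
`ℂ`-schemes. -/
def comap {ρ : Y ⟶ SpecC} {π : X ⟶ SpecC} (f : Y ⟶ X) (hf : f ≫ π = ρ) (y : Y) :
    LocalRingAt π (f y) →ₐ[ℂ] LocalRingAt ρ y where
  __ := (f.stalkMap y).hom
  commutes' z := by
    subst hf
    change ((Scheme.ΓSpecIso (.of ℂ)).inv ≫ π.appTop ≫ X.presheaf.germ ⊤ (f y) (TopologicalSpace.Opens.mem_top _) ≫
      f.stalkMap y).hom z =
      ((Scheme.ΓSpecIso (.of ℂ)).inv ≫ (f ≫ π).appTop ≫ Y.presheaf.germ ⊤ y (TopologicalSpace.Opens.mem_top y)).hom z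
    congr 2
    rw [Scheme.Hom.germ_stalkMap, Scheme.Hom.comp_appTop, Category.assoc]
    rfl

end LocalRingAt

/-! ### Smooth varieties, hypersurfaces and their infinitesimal neighbourhoods -/

/-- `X` is a smooth algebraic variety over `ℂ`: smooth, separated and of finite type. -/
structure IsSmoothVariety {X : Scheme.{0}} (π : X ⟶ SpecC) : Prop where
  smooth : Smooth π
  separated : IsSeparated π
  finiteType : LocallyOfFiniteType π
  quasiCompact : QuasiCompact π

section Subschemes

variable {X : Scheme.{0}} (π : X ⟶ SpecC) (I : X.IdealSheafData) (n : ℕ)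

/-- The structure morphism to `Spec ℂ` of the closed subscheme defined by `I`. -/
abbrev subStr : I.subscheme ⟶ SpecC := I.subschemeι ≫ π

/-- The closed subscheme defined by `I` is a smooth hypersurface of `X`: it is smooth over `ℂ` and
is locally given by one equation `f = 0`, with `f` a nonzerodivisor. -/
structure IsSmoothHypersurface : Prop where
  local_equation : ∀ x : X, ∃ (U : X.affineOpens) (f : Γ(X, U.1)),
    x ∈ U.1 ∧ f ∈ nonZeroDivisors Γ(X, U.1) ∧ I.ideal U = Ideal.span {f}
  smooth : Smooth (subStr π I)

lemma pow_le [NeZero n] : I ^ n ≤ I := fun _ => Ideal.pow_le_self (NeZero.ne n)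

/-- The inclusion `Y → Y_n`, where `Y` is the closed subscheme defined by `I` and `Y_n` the one
defined by `I ^ n`. -/
abbrev thickIncl [NeZero n] : I.subscheme ⟶ (I ^ n).subscheme :=
  Scheme.IdealSheafData.inclusion (pow_le I n)

/-- The restriction homomorphism `𝒪_{n,P} → 𝒪_{Y,P}` of `ℂ`-algebras. -/
abbrev restriction [NeZero n] (P : I.subscheme) :
    LocalRingAt (subStr π (I ^ n)) (thickIncl I n P) →ₐ[ℂ] LocalRingAt (subStr π I) P :=
  LocalRingAt.comap (thickIncl I n) (by simp) P

end Subschemes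

/-! ### Primitive multiple curves -/

/-- A (Noetherian) local ring is Cohen-Macaulay if its maximal ideal contains a regular sequence
whose length is the dimension of the ring. -/
def IsCohenMacaulayLocalRing (R : Type) [CommRing R] [IsLocalRing R] : Prop :=
  IsNoetherianRing R ∧ ∃ rs : List R, (∀ r ∈ rs, r ∈ IsLocalRing.maximalIdeal R) ∧
    RingTheory.Sequence.IsRegular R rs ∧ (rs.length : WithBot ℕ∞) = ringKrullDim R

/-- The closed subscheme `Y` of `X` defined by `I` is a primitive multiple curve: `Y` is
Cohen-Macaulay, `C = Y_red` (which is defined by the radical of `I`) is a smooth connected curve,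
and for every closed point `x` of `C` there is a surface `S` in `X` (with ideal sheaf `J`),
smooth at `x`, which contains a neighbourhood of `x` in `Y`. -/
structure IsPrimitiveMultipleCurve {X : Scheme.{0}} (π : X ⟶ SpecC) (I : X.IdealSheafData) :
    Prop where
  cohenMacaulay : ∀ y : I.subscheme, IsCohenMacaulayLocalRing (I.subscheme.presheaf.stalk y)
  smooth : SmoothOfRelativeDimension 1 (subStr π I.radical)
  connected : ConnectedSpace I.radical.subscheme
  surface : ∀ x ∈ I.support, IsClosed {x} → ∃ (J : X.IdealSheafData) (W : X.Opens), x ∈ W ∧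
    SmoothOfRelativeDimension 2 ((J.subschemeι ⁻¹ᵁ W).ι ≫ subStr π J) ∧
    ∀ V : X.affineOpens, V.1 ≤ W → J.ideal V ≤ I.ideal V

/-- The multiplicity of `Y` (defined by `I`) is the smallest `n` such that `Y` is contained in the
closed subscheme defined by `I_C ^ n`, where `C = Y_red`. -/
def IsMultiplicity {X : Scheme.{0}} (I : X.IdealSheafData) (n : ℕ) : Prop :=
  IsLeast {k : ℕ | I.radical ^ k ≤ I} n

end PrimitiveCurves

end

open PrimitiveCurves

/-! Both parts rest on truncated parameters (`IsTrunc`). Let `r : B → A` be a surjection of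
ℂ-algebras with kernel `fB`, where `f` is a truncated parameter of order `n`. The kernel is
nilpotent, so if `A` is formally smooth the identity of `A` lifts to a section `σ`. Expanding in
powers of `f` with coefficients in `σ(A)` gives `A ⊗ ℂ[t]/(t^n) ≃ B`, `t ↦ f`
(`exists_tensor_truncPoly_equiv`). On affine opens this is a chart `U × Z_n` (`exists_chart`). For
(A), `f` is a local equation of the hypersurface; being a nonzerodivisor, it becomes a truncated
parameter modulo `f^n` (`thickening_isTrunc`). For (B), at a closed point the local ring `B` of the
curve `Y` is a quotient of the local ring of a smooth surface, so its maximal ideal has two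
generators. They can be chosen as `u, f`, with `u` mapping to a uniformizer of `C` and `f` vanishing
on `C`. Krull's intersection theorem shows that `f` generates the kernel, and the regular element
provided by Cohen-Macaulayness shows that `f` is truncated (`exists_isTrunc_of_isLocalRing`). Such a
parameter spreads out to a neighbourhood (`exists_isTrunc_basicOpen`). Its order is locally
constant, hence constant on the connected curve `C`, and equals the multiplicity. The resulting
charts cover `Y`, and their transition maps are the cocycle
(`ChartFamily.isAbstractPrimitiveCurve`). -/

noncomputable section

namespace PrimitiveCurves

/-! ### Truncated parameters -/

/-- `f` behaves in `B` like `t` in `A[t]/(t^n)`: `f ^ n = 0` and each `f ^ i B / f ^ (i+1) B`, for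
`i < n`, is free of rank one over `B / f B`. -/
structure IsTrunc {B : Type*} [CommRing B] (f : B) (n : ℕ) : Prop where
  pow_eq_zero : f ^ n = 0
  dvd_of_dvd : ∀ i < n, ∀ x, f ^ (i + 1) ∣ f ^ i * x → f ∣ x

lemma IsTrunc.isNilpotent_ker {A B : Type*} [CommRing A] [CommRing B] {f : B} {n : ℕ}
    (hf : IsTrunc f n) (r : B →+* A) (hr : ∀ x, r x = 0 ↔ f ∣ x) :
    IsNilpotent (RingHom.ker r) := by
  have : RingHom.ker r = Ideal.span {f} :=
    Ideal.ext fun x => (hr x).trans Ideal.mem_span_singleton.symm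
  exact ⟨n, by rw [this, Ideal.span_singleton_pow, hf.pow_eq_zero]; simp⟩

lemma TruncPoly.t_pow (n : ℕ) : TruncPoly.t n ^ n = 0 := by
  rw [TruncPoly.t, ← map_pow, Ideal.Quotient.eq_zero_iff_mem]
  exact Ideal.mem_span_singleton_self _

lemma TruncPoly.exists_sum {n : ℕ} {A : Type*} [CommRing A] [Algebra ℂ A] (x : A ⊗[ℂ] TruncPoly n) :
    ∃ a : ℕ → A, x = ∑ i ∈ Finset.range n, a i ⊗ₜ (TruncPoly.t n ^ i) := by
  induction x using TensorProduct.induction_on with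
  | zero => exact ⟨0, by simp⟩
  | add x y hx hy =>
    obtain ⟨a, rfl⟩ := hx
    obtain ⟨b, rfl⟩ := hy
    exact ⟨a + b, by simp [TensorProduct.add_tmul, Finset.sum_add_distrib]⟩
  | tmul a p =>
    obtain ⟨q, rfl⟩ := Ideal.Quotient.mk_surjective p
    induction q using Polynomial.induction_on' with
    | add p q hp hq =>
      obtain ⟨b, hb⟩ := hp
      obtain ⟨c, hc⟩ := hq
      refine ⟨b + c, ?_⟩
      rw [map_add, TensorProduct.tmul_add, hb, hc]
      simp [TensorProduct.add_tmul, Finset.sum_add_distrib]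
    | monomial k c =>
      have h1 : (Ideal.Quotient.mk (Ideal.span {(Polynomial.X : ℂ[X]) ^ n}))
          (Polynomial.monomial k c) = c • TruncPoly.t n ^ k := by
        rw [← Polynomial.C_mul_X_pow_eq_monomial, ← Polynomial.smul_eq_C_mul]
        rfl
      rw [h1, ← TensorProduct.smul_tmul]
      by_cases hk : k < n
      · refine ⟨Pi.single k (c • a), ?_⟩
        rw [Finset.sum_eq_single_of_mem k (Finset.mem_range.mpr hk), Pi.single_eq_same]
        intro i _ hi
        rw [Pi.single_eq_of_ne hi, TensorProduct.zero_tmul]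
      · refine ⟨0, ?_⟩
        rw [← Nat.sub_add_cancel (not_lt.mp hk), pow_add, TruncPoly.t_pow]
        simp

/-- The map is `∑ a_i ⊗ t^i ↦ ∑ σ(a_i) f^i`. Truncatedness gives uniqueness of such expansions; `B =
σ(A) + fB` gives existence. -/
theorem exists_tensor_truncPoly_equiv {A B : Type*} [CommRing A] [CommRing B] [Algebra ℂ A]
    [Algebra ℂ B] {n : ℕ} {f : B} (hf : IsTrunc f n) (r : B →ₐ[ℂ] A)
    (hr : ∀ x, r x = 0 ↔ f ∣ x) (σ : A →ₐ[ℂ] B) (hσ : ∀ a, r (σ a) = a) :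
    ∃ e : (A ⊗[ℂ] TruncPoly n) ≃ₐ[ℂ] B, (∀ a, e (a ⊗ₜ 1) = σ a) ∧ e (1 ⊗ₜ TruncPoly.t n) = f := by
  let τ : TruncPoly n →ₐ[ℂ] B := Ideal.Quotient.liftₐ _ (Polynomial.aeval f) (by
    intro a ha
    obtain ⟨b, rfl⟩ := Ideal.mem_span_singleton.mp ha
    simp [hf.pow_eq_zero])
  have hτ : τ (TruncPoly.t n) = f := by
    change Polynomial.aeval f Polynomial.X = f
    simp
  let φ : (A ⊗[ℂ] TruncPoly n) →ₐ[ℂ] B := Algebra.TensorProduct.lift σ τ fun _ _ => Commute.all _ _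
  have hφ (a : ℕ → A) : φ (∑ i ∈ Finset.range n, a i ⊗ₜ (TruncPoly.t n ^ i)) =
      ∑ i ∈ Finset.range n, σ (a i) * f ^ i := by
    simp [φ, hτ]
  have hinj : Function.Injective φ := by
    rw [injective_iff_map_eq_zero]
    intro x hx
    obtain ⟨a, rfl⟩ := TruncPoly.exists_sum x
    rw [hφ] at hx
    -- The coefficients vanish in increasing order: once the lower ones are zero, `f^i σ(a_i)` is a
    -- multiple of `f^(i+1)`, so `f ∣ σ(a_i)`, and applying `r` gives `a_i = 0`.
    have key : ∀ i, i < n → a i = 0 := by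
      intro i
      induction i using Nat.strong_induction_on with
      | _ i ih =>
        intro hi
        have h0 : f ^ i * σ (a i) = - ∑ j ∈ Finset.Ico (i + 1) n, σ (a j) * f ^ j := by
          rw [← Finset.sum_range_add_sum_Ico _ (Nat.succ_le_of_lt hi), Finset.sum_range_succ,
            Finset.sum_eq_zero (s := Finset.range i)] at hx
          · linear_combination hx
          · intro j hj
            rw [ih j (Finset.mem_range.mp hj) ((Finset.mem_range.mp hj).trans hi), map_zero, zero_mul]
        have h1 : f ∣ σ (a i) := by
          refine hf.dvd_of_dvd i hi _ ?_
          rw [h0, dvd_neg]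
          exact Finset.dvd_sum fun j hj =>
            Dvd.dvd.mul_left (pow_dvd_pow _ (Finset.mem_Ico.mp hj).1) _
        rw [← hσ (a i), (hr _).mpr h1]
    exact Finset.sum_eq_zero fun i hi => by
      rw [key i (Finset.mem_range.mp hi), TensorProduct.zero_tmul]
  have hsurj : Function.Surjective φ := by
    intro x
    -- The `f`-adic expansion to order `k`, with remainder `f^k y`; the remainder disappears at `k =
    -- n`.
    have key : ∀ k, ∃ (a : ℕ → A) (y : B), x = ∑ i ∈ Finset.range k, σ (a i) * f ^ i + f ^ k * y := by
      intro k
      induction k with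
      | zero => exact ⟨0, x, by simp⟩
      | succ k ih =>
        obtain ⟨a, y, rfl⟩ := ih
        obtain ⟨z, hz⟩ : f ∣ y - σ (r y) := by rw [← hr, map_sub, hσ, sub_self]
        refine ⟨Function.update a k (r y), z, ?_⟩
        have h1 : ∑ i ∈ Finset.range k, σ (Function.update a k (r y) i) * f ^ i =
            ∑ i ∈ Finset.range k, σ (a i) * f ^ i :=
          Finset.sum_congr rfl fun i hi => by
            rw [Function.update_of_ne (Finset.mem_range.mp hi).ne]
        rw [Finset.sum_range_succ, Function.update_self, h1]
        linear_combination f ^ k * hz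
    obtain ⟨a, y, rfl⟩ := key n
    exact ⟨∑ i ∈ Finset.range n, a i ⊗ₜ (TruncPoly.t n ^ i), by
      rw [hφ, hf.pow_eq_zero, zero_mul, add_zero]⟩
  refine ⟨AlgEquiv.ofBijective φ ⟨hinj, hsurj⟩, fun a => ?_, ?_⟩
  · change φ (a ⊗ₜ 1) = _
    simp [φ]
  · change φ (1 ⊗ₜ _) = _
    simp [φ, hτ]

/-! ### Local structure -/

/-- The algebraic core of (B): `B` is the local ring of the multiple curve, `A` that of its
reduction with uniformizer `t`. The two generators of the maximal ideal reflect the smooth surface,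
and the regular element `r` rules out embedded points. -/
theorem exists_isTrunc_of_isLocalRing {B A : Type*} [CommRing B] [IsLocalRing B]
    [IsNoetherianRing B] [CommRing A] [IsLocalRing A] (φ : B →+* A) (hφ : Function.Surjective φ)
    (hnil : ∀ x, φ x = 0 → IsNilpotent x) (t : A) (ht : IsLocalRing.maximalIdeal A = Ideal.span {t})
    (ht0 : ¬ IsNilpotent t) (u v : B) (huv : IsLocalRing.maximalIdeal B = Ideal.span {u, v})
    (r : B) (hr : r ∈ IsLocalRing.maximalIdeal B) (hreg : IsSMulRegular B r) :
    ∃ (f : B) (n : ℕ), n ≠ 0 ∧ (∀ x, φ x = 0 ↔ f ∣ x) ∧ IsTrunc f n := by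
  -- A lift of the inverse of `φ x` inverts `x` up to a nilpotent error.
  have hloc : IsLocalHom φ := by
    refine ⟨fun x hx => ?_⟩
    obtain ⟨y, hy⟩ := hφ (↑(hx.unit⁻¹) : A)
    have h1 : φ (x * y - 1) = 0 := by rw [map_sub, map_mul, hy, map_one]; simp
    have h2 : IsUnit (x * y) := by
      have := (hnil _ h1).isUnit_add_one
      rwa [sub_add_cancel] at this
    exact isUnit_of_mul_isUnit_left h2
  have hmem (x : B) : x ∈ IsLocalRing.maximalIdeal B ↔ φ x ∈ IsLocalRing.maximalIdeal A := by
    simp [IsLocalRing.mem_maximalIdeal, mem_nonunits_iff]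
  -- one of the two generators of the maximal ideal of `B` generates that of `A`
  have hgen : ∃ u f : B, IsLocalRing.maximalIdeal B = Ideal.span {u, f} ∧ φ f = 0 ∧
      ¬ IsNilpotent (φ u) := by
    have aux : ∀ u v : B, IsLocalRing.maximalIdeal B = Ideal.span {u, v} → ∀ a b : A,
        φ u = t * a → φ v = t * b → IsUnit a →
        ∃ u f : B, IsLocalRing.maximalIdeal B = Ideal.span {u, f} ∧ φ f = 0 ∧
          ¬ IsNilpotent (φ u) := by
      intro u v huv a b hu hv ha
      obtain ⟨s, hs⟩ := hφ (↑(ha.unit⁻¹) * b)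
      refine ⟨u, v - u * s, ?_, ?_, ?_⟩
      · rw [huv]
        apply le_antisymm <;> rw [Ideal.span_le] <;> rintro x (rfl | rfl)
        · exact Ideal.subset_span (by simp)
        · exact Ideal.mem_span_pair.mpr ⟨s, 1, by ring⟩
        · exact Ideal.subset_span (by simp)
        · exact Ideal.mem_span_pair.mpr ⟨-s, 1, by ring⟩
      · rw [map_sub, map_mul, hs, hu, hv]
        linear_combination - t * b * ha.mul_val_inv
      · rw [hu]
        intro h
        apply ht0
        obtain ⟨k, hk⟩ := h
        exact ⟨k, by rw [mul_pow] at hk; exact (ha.pow k).mul_left_eq_zero.mp hk⟩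
    obtain ⟨a, ha⟩ : t ∣ φ u := by
      rw [← Ideal.mem_span_singleton, ← ht, ← hmem, huv]; exact Ideal.subset_span (by simp)
    obtain ⟨b, hb⟩ : t ∣ φ v := by
      rw [← Ideal.mem_span_singleton, ← ht, ← hmem, huv]; exact Ideal.subset_span (by simp)
    obtain ⟨t', rfl⟩ := hφ t
    have : t' ∈ IsLocalRing.maximalIdeal B := by rw [hmem, ht]; exact Ideal.mem_span_singleton_self _
    rw [huv, Ideal.mem_span_pair] at this
    obtain ⟨c, d, hcd⟩ := this
    have h1 : φ t' * (1 - (φ c * a + φ d * b)) = 0 := by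
      have := congrArg φ hcd
      rw [map_add, map_mul, map_mul, ha, hb] at this
      linear_combination -this
    -- If `1 - (φ c * a + φ d * b)` were a unit, `h1` would give `t = 0`. So the sum is a unit and
    -- one of `a`, `b` is: the corresponding generator maps to a uniformizer.
    rcases IsLocalRing.isUnit_or_isUnit_one_sub_self (φ c * a + φ d * b) with h | h
    · rcases IsLocalRing.isUnit_or_isUnit_of_isUnit_add h with h | h
      · exact aux u v huv a b ha hb (isUnit_of_mul_isUnit_right h)
      · exact aux v u (by rw [huv, Set.pair_comm]) b a hb ha (isUnit_of_mul_isUnit_right h)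
    · exact absurd (h.mul_left_eq_zero.mp h1 ▸ IsNilpotent.zero) ht0
  clear huv u v
  obtain ⟨u, f, huf, hf0, hu⟩ := hgen
  have hu0 (k : ℕ) : φ u ^ k ≠ 0 := fun h => hu ⟨k, h⟩
  -- every element is a unit times a power of `u`, modulo `f`
  have hkrull (x : B) (hx : ∀ k, ∃ c w, x = f * c + u ^ k * w) : f ∣ x := by
    have hu_mem : u ∈ IsLocalRing.maximalIdeal B := by
      rw [huf]; exact Ideal.subset_span (by simp)
    -- Krull's intersection theorem for the module `B/(f)`.
    have := Ideal.iInf_pow_smul_eq_bot_of_isLocalRing (M := B ⧸ Ideal.span {f})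
      (IsLocalRing.maximalIdeal B) (Ideal.IsPrime.ne_top inferInstance)
    rw [← Ideal.mem_span_singleton, ← Ideal.Quotient.eq_zero_iff_mem, ← Submodule.mem_bot B, ← this,
      Submodule.mem_iInf]
    intro k
    obtain ⟨c, w, rfl⟩ := hx k
    have h1 : (Ideal.Quotient.mk (Ideal.span {f})) (f * c + u ^ k * w) =
        u ^ k • Ideal.Quotient.mk (Ideal.span {f}) w := by
      rw [Algebra.smul_def, Ideal.Quotient.algebraMap_eq, ← map_mul, Ideal.Quotient.eq,
        Ideal.mem_span_singleton]
      exact ⟨c, by ring⟩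
    rw [h1]
    exact Submodule.smul_mem_smul (Ideal.pow_mem_pow hu_mem k) trivial
  -- As long as the cofactor `w` is not a unit it lies in `(u, f)`, so one more factor `u` splits
  -- off modulo `f`. If this never stops, `hkrull` applies.
  have hdec (x : B) : f ∣ x ∨ ∃ k c w, IsUnit w ∧ x = f * c + u ^ k * w := by
    by_contra! h
    refine h.1 (hkrull x fun k => ?_)
    induction k with
    | zero => exact ⟨0, x, by simp⟩
    | succ k ih =>
      obtain ⟨c, w, hx⟩ := ih
      have hw : w ∈ IsLocalRing.maximalIdeal B := fun hw => h.2 k c w hw hx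
      rw [huf, Ideal.mem_span_pair] at hw
      obtain ⟨a, b, rfl⟩ := hw
      exact ⟨c + u ^ k * b, a, by rw [hx]; ring⟩
  have hker (x : B) : φ x = 0 ↔ f ∣ x := by
    constructor
    · intro hx
      rcases hdec x with h | ⟨k, c, w, hw, rfl⟩
      · exact h
      · rw [map_add, map_mul, map_mul, hf0, zero_mul, zero_add, map_pow,
          (hw.map φ).mul_left_eq_zero] at hx
        exact absurd hx (hu0 k)
    · rintro ⟨c, rfl⟩
      rw [map_mul, hf0, zero_mul]
  classical
  have hfn : ∃ n, f ^ n = 0 := hnil f hf0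
  -- The order is the least exponent killing `f`; its minimality supplies the final contradiction.
  refine ⟨f, Nat.find hfn, ?_, hker, Nat.find_spec hfn, ?_⟩
  · intro h
    have := Nat.find_spec hfn
    rw [h, pow_zero] at this
    exact one_ne_zero this
  · rintro i hi x ⟨y, hy⟩
    have hz0 : f ^ i * (x - f * y) = 0 := by rw [mul_sub, hy]; ring
    suffices h : f ∣ x - f * y by
      have := dvd_add h (dvd_mul_right f y)
      rwa [sub_add_cancel] at this
    rcases hdec (x - f * y) with h | ⟨k, c, w, hw, hz⟩
    · exact h
    exfalso
    -- If `f` does not divide `z = x - f y`, then `z = f c + u^k w` with `w` a unit, and `f^i z = 0`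
    -- puts `f^i u^k` in `(f^(i+1))`. Since `r ≡ a u` modulo `f`, the same holds for `f^i r^k`.
    -- Multiplication by `r^k` thus raises the power of `f` repeatedly until it vanishes; regularity
    -- of `r` forces `f^i = 0` with `i` below the minimal exponent.
    obtain ⟨w', hw'⟩ := hw.exists_right_inv
    rw [huf, Ideal.mem_span_pair] at hr
    obtain ⟨a, b, hab⟩ := hr
    obtain ⟨d, hd⟩ : f ∣ r ^ k - (a * u) ^ k := by
      have h1 : f ∣ r - a * u := ⟨b, by rw [← hab]; ring⟩
      exact h1.trans (sub_dvd_pow_sub_pow _ _ _)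
    have h2 : f ^ i * r ^ k = f ^ (i + 1) * (d - a ^ k * c * w') := by
      have : f ^ i * (f * c + u ^ k * w) = 0 := hz ▸ hz0
      linear_combination f ^ i * hd + f ^ i * a ^ k * u ^ k * (- hw') + a ^ k * w' * this
    have h3 : ∀ m, ∃ e, f ^ i * (r ^ k) ^ m = f ^ (i + m) * e := by
      intro m
      induction m with
      | zero => exact ⟨1, by simp⟩
      | succ m ih =>
        obtain ⟨e, he⟩ := ih
        refine ⟨(d - a ^ k * c * w') * e, ?_⟩
        rw [pow_succ (r ^ k), ← mul_assoc, he, pow_add f i m]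
        linear_combination f ^ m * e * h2
    obtain ⟨e, he⟩ := h3 (Nat.find hfn)
    rw [pow_add, Nat.find_spec hfn, mul_zero, zero_mul] at he
    have h4 : f ^ i = 0 := by
      have h5 : IsSMulRegular B ((r ^ k) ^ Nat.find hfn) := (hreg.pow k).pow _
      exact h5 (by simpa [smul_eq_mul, mul_comm] using he)
    exact Nat.find_min hfn hi h4

/-- A Cohen-Macaulay local ring containing a non-nilpotent non-unit contains a regular non-unit. -/
lemma IsCohenMacaulayLocalRing.exists_isSMulRegular {B : Type} [CommRing B] [IsLocalRing B]
    (h : IsCohenMacaulayLocalRing B) (u : B) (hu : u ∈ IsLocalRing.maximalIdeal B)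
    (hu0 : ¬ IsNilpotent u) : ∃ r ∈ IsLocalRing.maximalIdeal B, IsSMulRegular B r := by
  obtain ⟨-, rs, hrs, hreg, hdim⟩ := h
  cases rs with
  | nil =>
    have : Ring.KrullDimLE 0 B := by
      rw [Ring.krullDimLE_iff, ← hdim]
      simp
    exact absurd (Ring.KrullDimLE.isNilpotent_iff_mem_maximalIdeal.mpr hu) hu0
  | cons r rs =>
    exact ⟨r, hrs r (by simp), ((RingTheory.Sequence.isRegular_cons_iff _ _ _).mp hreg).1⟩

/-! ### Maximal ideals of the local rings of smooth schemes -/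

lemma mvPolynomial_sub_C_eval_mem {ι : Type*} (c : ι → ℂ) (f : MvPolynomial ι ℂ) :
    f - MvPolynomial.C (MvPolynomial.eval c f) ∈
      Ideal.span (Set.range fun i => (MvPolynomial.X i - MvPolynomial.C (c i) : MvPolynomial ι ℂ)) := by
  rw [← Ideal.Quotient.eq]
  set I := Ideal.span (Set.range fun i => (MvPolynomial.X i - MvPolynomial.C (c i) : MvPolynomial ι ℂ))
  have : Ideal.Quotient.mk I =
      ((Ideal.Quotient.mk I).comp MvPolynomial.C).comp (MvPolynomial.eval c) := by
    refine MvPolynomial.ringHom_ext (fun r => by simp) fun i => ?_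
    simp only [RingHom.comp_apply, MvPolynomial.eval_X]
    rw [Ideal.Quotient.eq]
    exact Ideal.subset_span ⟨i, rfl⟩
  exact congr($this f)

/-- Nullstellensatz: `S/q` is a field of finite type over ℂ, hence equal to ℂ, and `c` collects the
images of the variables in it. -/
lemma exists_comap_eq_span_of_isMaximal {ι S : Type*} [Finite ι] [CommRing S]
    (g : MvPolynomial ι ℂ →+* S) (hg : g.FiniteType) (q : Ideal S) [q.IsMaximal] :
    ∃ c : ι → ℂ, q.comap g =
      Ideal.span (Set.range fun i => (MvPolynomial.X i - MvPolynomial.C (c i) : MvPolynomial ι ℂ)) := by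
  let : Field (S ⧸ q) := Ideal.Quotient.field q
  let h : ℂ →+* S ⧸ q := ((Ideal.Quotient.mk q).comp g).comp MvPolynomial.C
  let := h.toAlgebra
  have hft : h.FiniteType := by
    refine RingHom.FiniteType.comp (RingHom.FiniteType.comp ?_ hg) ?_
    · exact RingHom.FiniteType.of_surjective _ Ideal.Quotient.mk_surjective
    · exact (RingHom.finiteType_algebraMap (A := ℂ) (B := MvPolynomial ι ℂ)).mpr inferInstance
  have : Algebra.FiniteType ℂ (S ⧸ q) := hft
  have : Module.Finite ℂ (S ⧸ q) := finite_of_finite_type_of_isJacobsonRing _ _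
  have hsurj : Function.Surjective h :=
    (IsAlgClosed.algebraMap_bijective_of_isIntegral (k := ℂ) (K := S ⧸ q)).2
  choose c hc using fun i => hsurj (Ideal.Quotient.mk q (g (MvPolynomial.X i)))
  have hle : Ideal.span (Set.range fun i =>
      (MvPolynomial.X i - MvPolynomial.C (c i) : MvPolynomial ι ℂ)) ≤ q.comap g := by
    rw [Ideal.span_le]
    rintro _ ⟨i, rfl⟩
    change g _ ∈ q
    rw [← Ideal.Quotient.eq_zero_iff_mem, map_sub, map_sub, ← hc i, sub_eq_zero]
    rfl
  refine ⟨c, le_antisymm (fun f hf => ?_) hle⟩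
  have h1 := mvPolynomial_sub_C_eval_mem c f
  have h2 : MvPolynomial.C (MvPolynomial.eval c f) ∈ q.comap g := by
    have := sub_mem hf (hle h1)
    rwa [sub_sub_cancel] at this
  have h3 : h (MvPolynomial.eval c f) = 0 := Ideal.Quotient.eq_zero_iff_mem.mpr h2
  rw [map_eq_zero] at h3
  rwa [h3, map_zero, sub_zero] at h1

/-- Étale coordinates: `S` is étale over a polynomial ring in `d` variables. Unramifiedness makes
the functions `X_i - c_i` generate the maximal ideal upstairs; flatness keeps each of them regular.
-/
theorem exists_maximalIdeal_eq_span_of_isStandardSmooth {S : Type*} [CommRing S] {f : ℂ →+* S}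
    {d : ℕ} (hf : f.IsStandardSmoothOfRelativeDimension d) (q : Ideal S) [q.IsMaximal]
    (L : Type*) [CommRing L] [IsLocalRing L] [Algebra S L] [IsLocalization.AtPrime L q] :
    ∃ x : Fin d → L, IsLocalRing.maximalIdeal L = Ideal.span (Set.range x) ∧
      ∀ i, IsSMulRegular L (x i) := by
  obtain ⟨g, -, hg⟩ := hf.exists_etale_mvPolynomial
  let := g.toAlgebra
  have : Algebra.Etale (MvPolynomial (Fin d) ℂ) S := hg
  have hft : Algebra.FiniteType (MvPolynomial (Fin d) ℂ) S := inferInstance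
  obtain ⟨c, hc⟩ := exists_comap_eq_span_of_isMaximal g hft q
  have hqp : (q.comap g).IsPrime := Ideal.comap_isPrime g q
  have : q.LiesOver (q.comap g) := ⟨rfl⟩
  let := Localization.AtPrime.algebraOfLiesOver (q.comap g) q
  have h1 := ((Algebra.isUnramifiedAt_iff_map_eq (MvPolynomial (Fin d) ℂ) (q.comap g) q).mp
    (inferInstanceAs (Algebra.FormallyUnramified _ _))).2
  let e : Localization.AtPrime q ≃ₐ[S] L := IsLocalization.algEquiv q.primeCompl _ _
  refine ⟨fun i => algebraMap S L (g (MvPolynomial.X i - MvPolynomial.C (c i))), ?_, fun i => ?_⟩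
  · have h2 : (IsLocalRing.maximalIdeal (Localization.AtPrime q)).map e.toRingEquiv.toRingHom =
        IsLocalRing.maximalIdeal L := IsLocalRing.map_ringEquiv_maximalIdeal e.toRingEquiv
    rw [← h2, ← h1, hc, Ideal.map_span, Ideal.map_span, ← Set.range_comp, ← Set.range_comp]
    congr 2
    funext i
    change e (algebraMap _ (Localization.AtPrime q) _) = _
    rw [IsScalarTower.algebraMap_apply (MvPolynomial (Fin d) ℂ) S (Localization.AtPrime q)]
    exact e.commutes _
  · have hreg : IsSMulRegular (MvPolynomial (Fin d) ℂ)
        (MvPolynomial.X i - MvPolynomial.C (c i) : MvPolynomial (Fin d) ℂ) := by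
      apply IsRegular.left ∘ IsRegular.of_ne_zero
      intro h
      have := congrArg (MvPolynomial.eval fun _ => c i + 1) h
      simp at this
    have h3 := hreg.of_flat (S := S)
    have : Module.Flat S L := IsLocalization.flat L q.primeCompl
    exact h3.of_flat (S := L)

/-! ### Localization of truncated parameters -/

section Localization

variable {A B A' B' : Type*} [CommRing A] [CommRing B] [CommRing A'] [CommRing B']
  [Algebra A A'] [Algebra B B'] (φ : B →+* A) (φ' : B' →+* A')
  (hφ' : ∀ x, φ' (algebraMap B B' x) = algebraMap A A' (φ x))
  (M : Submonoid B) [IsLocalization (M.map φ) A']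

include hφ' in
lemma map_algebraMap_eq_zero_iff (x : B) :
    φ' (algebraMap B B' x) = 0 ↔ ∃ s ∈ M, φ (s * x) = 0 := by
  rw [hφ', IsLocalization.map_eq_zero_iff (M.map φ)]
  constructor
  · rintro ⟨⟨_, s, hs, rfl⟩, h⟩
    exact ⟨s, hs, by rw [map_mul]; exact h⟩
  · rintro ⟨s, hs, h⟩
    exact ⟨⟨_, s, hs, rfl⟩, by rw [← map_mul]; exact h⟩

variable {φ} [IsLocalization M B']

/-- The conditions on `f` are required only up to a factor in `M`. With the factor `1` this carries
a parameter on an affine open to a stalk; with `M` the powers of `g` it produces a parameter on a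
principal open. -/
lemma IsTrunc.of_isLocalization {f : B} {n : ℕ} (h0 : ∃ s ∈ M, s * f ^ n = 0)
    (h : ∀ i < n, ∀ x, f ^ (i + 1) ∣ f ^ i * x → ∃ s ∈ M, f ∣ s * x) :
    IsTrunc (algebraMap B B' f) n := by
  constructor
  · obtain ⟨s, hs, h⟩ := h0
    rw [← map_pow, IsLocalization.map_eq_zero_iff M]
    exact ⟨⟨s, hs⟩, h⟩
  · rintro i hi x ⟨y, hxy⟩
    obtain ⟨⟨x, s⟩, hx⟩ := IsLocalization.surj M x
    obtain ⟨⟨y, t⟩, hy⟩ := IsLocalization.surj M y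
    dsimp only at hx hy
    have h1 : algebraMap B B' (f ^ i * (x * t)) = algebraMap B B' (f ^ (i + 1) * (y * s)) := by
      simp only [map_mul, map_pow, ← hx, ← hy]
      linear_combination algebraMap B B' s * algebraMap B B' t * hxy
    obtain ⟨w, hw⟩ := (IsLocalization.eq_iff_exists M B').mp h1
    obtain ⟨s', hs', h2⟩ := h i hi (w * (x * t)) ⟨w * (y * s), by linear_combination hw⟩
    have h3 : IsUnit (algebraMap B B' (s' * w * s * t)) :=
      IsLocalization.map_units B' (⟨s', hs'⟩ * w * s * t : M)
    rw [← h3.dvd_mul_left]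
    have h4 := map_dvd (algebraMap B B') h2
    convert h4 using 1
    simp only [map_mul]
    linear_combination algebraMap B B' s' * algebraMap B B' w * algebraMap B B' t * hx

include hφ' in
lemma map_eq_zero_iff_dvd_of_isLocalization {f : B} (h0 : φ f = 0)
    (h : ∀ x, φ x = 0 → ∃ s ∈ M, f ∣ s * x) (x : B') :
    φ' x = 0 ↔ algebraMap B B' f ∣ x := by
  constructor
  · intro hx
    obtain ⟨⟨x', s⟩, hs⟩ := IsLocalization.surj M x
    have h1 : φ' (algebraMap B B' x') = 0 := by
      rw [← hs, map_mul, hx, zero_mul]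
    obtain ⟨t, ht, h2⟩ := (map_algebraMap_eq_zero_iff φ φ' hφ' M x').mp h1
    obtain ⟨w, hw, h3⟩ := h _ h2
    have h4 : IsUnit (algebraMap B B' (w * t * s)) :=
      IsLocalization.map_units B' (⟨w, hw⟩ * ⟨t, ht⟩ * s : M)
    rw [← h4.dvd_mul_left]
    have h5 := map_dvd (algebraMap B B') h3
    convert h5 using 1
    simp only [map_mul]
    linear_combination algebraMap B B' w * algebraMap B B' t * hs
  · rintro ⟨y, rfl⟩
    rw [map_mul, hφ', h0, map_zero, zero_mul]

/-- A common denominator is the product of those of finitely many generators of `K`. -/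
lemma exists_mem_forall_dvd [IsNoetherianRing B] (K : Ideal B) (f : B)
    (h : ∀ x ∈ K, ∃ s ∈ M, f ∣ s * x) : ∃ s ∈ M, ∀ x ∈ K, f ∣ s * x := by
  classical
  obtain ⟨S, rfl⟩ := IsNoetherian.noetherian K
  choose! s hs hd using h
  refine ⟨∏ y ∈ S, s y, prod_mem fun y hy => hs y (Ideal.subset_span hy), fun x hx => ?_⟩
  induction hx using Submodule.span_induction with
  | mem x hx =>
    refine (hd x (Ideal.subset_span hx)).trans ?_
    exact mul_dvd_mul_right (Finset.dvd_prod_of_mem s hx) x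
  | zero => simp
  | add x y _ _ hx hy => rw [mul_add]; exact dvd_add hx hy
  | smul a x _ hx => rw [smul_eq_mul, mul_left_comm]; exact hx.mul_left a

include hφ' in
/-- A truncated parameter of a localization comes from one of a principal localization. -/
lemma exists_of_isTrunc_localization [IsNoetherianRing B] {f' : B'} {n : ℕ} (hf : IsTrunc f' n)
    (hf' : ∀ x, φ' x = 0 ↔ f' ∣ x) :
    ∃ g ∈ M, ∃ f : B, φ f = 0 ∧ (∀ x, φ x = 0 → f ∣ g * x) ∧ g * f ^ n = 0 ∧
      ∀ i < n, ∀ x, f ^ (i + 1) ∣ f ^ i * x → f ∣ g * x := by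
  obtain ⟨⟨f₁, s₁⟩, hf₁⟩ := IsLocalization.surj M f'
  dsimp only at hf₁
  have hu₁ := IsLocalization.map_units B' s₁
  -- The numerator `f₁` maps to zero only after localization; multiplying by `s₂` makes it vanish
  -- under `φ` itself, at the cost of a unit of `B'`.
  obtain ⟨s₂, hs₂, hf₂⟩ := (map_algebraMap_eq_zero_iff φ φ' hφ' M f₁).mp
    (by rw [← hf₁, map_mul, (hf' f').mpr dvd_rfl, zero_mul])
  have hu₂ := IsLocalization.map_units B' (⟨s₂, hs₂⟩ : M)
  set f := s₂ * f₁ with hfdef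
  have hassoc : Associated f' (algebraMap B B' f) := by
    refine ⟨(hu₁.mul hu₂).unit, ?_⟩
    rw [IsUnit.unit_spec, ← mul_assoc, hf₁, hfdef, map_mul, mul_comm]
  have key (x : B) (hx : algebraMap B B' f ∣ algebraMap B B' x) : ∃ s ∈ M, f ∣ s * x := by
    obtain ⟨y, hy⟩ := hx
    obtain ⟨⟨y, t⟩, ht⟩ := IsLocalization.surj M y
    dsimp only at ht
    have h1 : algebraMap B B' (t * x) = algebraMap B B' (f * y) := by
      rw [map_mul, map_mul, hy, ← ht]; ring
    obtain ⟨w, hw⟩ := (IsLocalization.eq_iff_exists M B').mp h1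
    exact ⟨w * t, mul_mem w.2 t.2, w * y, by linear_combination hw⟩
  obtain ⟨g₁, hg₁, h₁⟩ := exists_mem_forall_dvd M (RingHom.ker φ) f fun x hx => by
    refine key x ?_
    rw [← hassoc.dvd_iff_dvd_left, ← hf', hφ', (RingHom.mem_ker).mp hx, map_zero]
  have hpow : algebraMap B B' (f ^ n) = 0 := by
    obtain ⟨w, hw⟩ := hassoc
    rw [map_pow, ← hw, mul_pow, hf.pow_eq_zero, zero_mul]
  obtain ⟨⟨g₂, hg₂⟩, h₂⟩ := (IsLocalization.map_eq_zero_iff M B' _).mp hpow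
  have h₃ (i : ℕ) (hi : i < n) : ∃ g ∈ M, ∀ x, f ^ (i + 1) ∣ f ^ i * x → f ∣ g * x := by
    -- The elements `x` with `f^(i+1) ∣ f^i x` form the colon ideal `(f^(i+1) : f^i)`, which is
    -- finitely generated, so one denominator serves them all.
    obtain ⟨g, hg, h⟩ := exists_mem_forall_dvd M
      ((Ideal.span {f ^ (i + 1)}).colon {f ^ i}) f fun x hx => by
        refine key x ?_
        rw [Submodule.mem_colon_singleton, Ideal.mem_span_singleton, smul_eq_mul] at hx
        rw [← hassoc.dvd_iff_dvd_left]
        refine hf.dvd_of_dvd i hi _ ?_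
        obtain ⟨w, hw⟩ := hassoc
        have h4 := map_dvd (algebraMap B B') hx
        rw [map_mul, map_pow, map_pow, ← hw, mul_pow, mul_pow,
          (w.isUnit.pow _).mul_right_dvd] at h4
        rw [← (w.isUnit.pow i).dvd_mul_right]
        convert h4 using 1
        ring
    exact ⟨g, hg, fun x hx => h x (by
      rwa [Submodule.mem_colon_singleton, Ideal.mem_span_singleton, smul_eq_mul, mul_comm])⟩
  choose! g₃ hg₃ h₃ using h₃
  refine ⟨g₁ * g₂ * ∏ i ∈ Finset.range n, g₃ i,
    mul_mem (mul_mem hg₁ hg₂) (prod_mem fun i hi => hg₃ i (Finset.mem_range.mp hi)), f, hf₂,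
    fun x hx => ?_, ?_, fun i hi x hx => ?_⟩
  · refine (h₁ x hx).trans ⟨g₂ * ∏ i ∈ Finset.range n, g₃ i, by ring⟩
  · linear_combination (g₁ * ∏ i ∈ Finset.range n, g₃ i) * h₂
  · refine (h₃ i hi x hx).trans (mul_dvd_mul_right ?_ x)
    exact (Finset.dvd_prod_of_mem g₃ (Finset.mem_range.mpr hi)).mul_left _

end Localization

/-! ### Gluing charts -/

section Gluing

variable {C : Scheme.{0}} {π : C ⟶ SpecC} {n : ℕ} [NeZero n]

lemma prodZ.zero_fst : prodZ.zero π n ≫ prodZ.fst π n = 𝟙 C := pullback.lift_fst _ _ _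

lemma prodZ.zero_preimage (U : C.Opens) :
    (prodZ.zero π n) ⁻¹ᵁ ((prodZ.fst π n) ⁻¹ᵁ U) = U := by
  rw [← Scheme.Hom.comp_preimage, prodZ.zero_fst]
  rfl

instance (U : C.Opens) : Surjective (prodZ.zeroOn π n U) :=
  IsZariskiLocalAtTarget.restrict (P := @Surjective) inferInstance _

lemma prodZ.zeroOn_incl {W U : C.Opens} (h : W ≤ U) :
    prodZ.zeroOn π n W ≫ prodZ.incl π n h =
      C.homOfLE (Scheme.Hom.preimage_mono _ (Scheme.Hom.preimage_mono _ h)) ≫ prodZ.zeroOn π n U := by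
  rw [← cancel_mono (Scheme.Opens.ι _)]
  simp

namespace Cocycle

variable (c : Cocycle π n)

lemma chart_condition (i k : c.J) :
    prodZ.incl π n (inf_le_left : c.U i ⊓ c.U k ≤ c.U i) ≫ c.chart i =
      (c.g i k).iso.hom ≫ prodZ.incl π n inf_le_right ≫ c.chart k := by
  have h := c.glueData.glue_condition i k
  change ((c.g i k).iso.hom ≫ prodZ.incl π n (le_of_eq (inf_comm (c.U i) (c.U k)))) ≫
    prodZ.incl π n (inf_le_left : c.U k ⊓ c.U i ≤ c.U k) ≫ c.chart k =
    prodZ.incl π n inf_le_left ≫ c.chart i at h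
  rw [← h, Category.assoc, Scheme.homOfLE_homOfLE_assoc]

lemma glued_hom_ext {Y : Scheme.{0}} {f f' : c.glued ⟶ Y}
    (h : ∀ i, c.chart i ≫ f = c.chart i ≫ f') : f = f' :=
  Multicoequalizer.hom_ext _ _ _ h

lemma exists_desc {Y : Scheme.{0}} (b : ∀ i, prodZ.over π n (c.U i) ⟶ Y)
    (hb : ∀ i k, prodZ.incl π n (inf_le_left : c.U i ⊓ c.U k ≤ c.U i) ≫ b i =
      (c.g i k).iso.hom ≫ prodZ.incl π n inf_le_right ≫ b k) :
    ∃ f : c.glued ⟶ Y, ∀ i, c.chart i ≫ f = b i := by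
  have hb' (i k : c.J) : prodZ.incl π n (inf_le_left : c.U i ⊓ c.U k ≤ c.U i) ≫ b i =
      ((c.g i k).iso.hom ≫ prodZ.incl π n (le_of_eq (inf_comm (c.U i) (c.U k)))) ≫
        prodZ.incl π n (inf_le_left : c.U k ⊓ c.U i ≤ c.U k) ≫ b k := by
    rw [hb, Category.assoc, Scheme.homOfLE_homOfLE_assoc]
  exact ⟨Multicoequalizer.desc c.glueData.diagram _ b (fun ij => hb' ij.1 ij.2),
    fun i => Multicoequalizer.π_desc _ _ _ _ _⟩

end Cocycle

/-- A family of charts of `Y`: open immersions `U_i × Z_n → Y` of `ℂ`-schemes extending the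
restriction to `U_i` of a given morphism `C → Y`, the `U_i` forming an open cover of `C`. -/
structure ChartFamily {C Y : Scheme.{0}} (ρ : Y ⟶ SpecC) (j : C ⟶ Y) (n : ℕ) [NeZero n] where
  /-- the indices of the cover -/
  J : Type
  /-- the members of the cover -/
  U : J → C.Opens
  iSup_U : ⨆ i, U i = ⊤
  /-- the charts -/
  a : ∀ i, prodZ.over (j ≫ ρ) n (U i) ⟶ Y
  isOpenImmersion : ∀ i, IsOpenImmersion (a i)
  a_str : ∀ i, a i ≫ ρ = Scheme.Opens.ι _ ≫ prodZ.str (j ≫ ρ) n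
  zeroOn_a : ∀ i, prodZ.zeroOn (j ≫ ρ) n (U i) ≫ a i = Scheme.Opens.ι _ ≫ j

namespace ChartFamily

attribute [instance] ChartFamily.isOpenImmersion

variable {Y : Scheme.{0}} {ρ : Y ⟶ SpecC} {j : C ⟶ Y} (A : ChartFamily ρ j n)

lemma zeroOn_incl_a {i : A.J} {W : C.Opens} (h : W ≤ A.U i) :
    prodZ.zeroOn (j ≫ ρ) n W ≫ prodZ.incl (j ≫ ρ) n h ≫ A.a i = Scheme.Opens.ι _ ≫ j := by
  rw [reassoc_of% (prodZ.zeroOn_incl (π := j ≫ ρ) (n := n) h), A.zeroOn_a, Scheme.homOfLE_ι_assoc]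

lemma incl_a_str {i : A.J} {W : C.Opens} (h : W ≤ A.U i) :
    prodZ.incl (j ≫ ρ) n h ≫ A.a i ≫ ρ = Scheme.Opens.ι _ ≫ prodZ.str (j ≫ ρ) n := by
  rw [A.a_str, Scheme.homOfLE_ι_assoc]

/-- `W → W × Z_n` is surjective, so the image of a chart is read off on `C`. In particular two
charts have the same image over a common open set, which is what makes `transition` possible. -/
lemma range_incl_a {i : A.J} {W : C.Opens} (h : W ≤ A.U i) :
    Set.range (prodZ.incl (j ≫ ρ) n h ≫ A.a i) = j '' W := by
  have h1 : Set.range (prodZ.incl (j ≫ ρ) n h ≫ A.a i) =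
      Set.range (prodZ.zeroOn (j ≫ ρ) n W ≫ prodZ.incl (j ≫ ρ) n h ≫ A.a i) := by
    rw [Scheme.Hom.comp_base (prodZ.zeroOn _ _ _), TopCat.coe_comp, Set.range_comp,
      (prodZ.zeroOn (j ≫ ρ) n W).surjective.range_eq, Set.image_univ]
  rw [h1, A.zeroOn_incl_a, Scheme.Hom.comp_base, TopCat.coe_comp, Set.range_comp,
    Scheme.Opens.range_ι, prodZ.zero_preimage]

/-- The change of charts on `U_i ∩ U_k`. -/
def transition (i k : A.J) : prodZ.over (j ≫ ρ) n (A.U i ⊓ A.U k) ≅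
    prodZ.over (j ≫ ρ) n (A.U i ⊓ A.U k) :=
  IsOpenImmersion.isoOfRangeEq (prodZ.incl (j ≫ ρ) n inf_le_left ≫ A.a i)
    (prodZ.incl (j ≫ ρ) n inf_le_right ≫ A.a k) (by rw [range_incl_a, range_incl_a])

lemma transition_hom (i k : A.J) :
    (A.transition i k).hom ≫ prodZ.incl (j ≫ ρ) n inf_le_right ≫ A.a k =
    prodZ.incl (j ≫ ρ) n inf_le_left ≫ A.a i :=
  IsOpenImmersion.isoOfRangeEq_hom_fac _ _ _

/-- The change of charts as an element of `𝒢_n(U_i ∩ U_k)`. -/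
def g (i k : A.J) : G (j ≫ ρ) n (A.U i ⊓ A.U k) where
  iso := A.transition i k
  over_base := by
    rw [← A.incl_a_str (W := A.U i ⊓ A.U k) inf_le_right, reassoc_of% (A.transition_hom i k),
      A.incl_a_str, A.incl_a_str]
  fix_zero := by
    rw [← cancel_mono (prodZ.incl (j ≫ ρ) n inf_le_right ≫ A.a k), Category.assoc, A.transition_hom,
      A.zeroOn_incl_a, A.zeroOn_incl_a]

lemma g_res {i k : A.J} {W : C.Opens} (h : W ≤ A.U i ⊓ A.U k) :
    (A.g i k).res h ≫ prodZ.incl (j ≫ ρ) n (h.trans inf_le_right) ≫ A.a k =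
      prodZ.incl (j ≫ ρ) n (h.trans inf_le_left) ≫ A.a i := by
  have h1 := (A.g i k).res_incl h =≫ (prodZ.incl (j ≫ ρ) n inf_le_right ≫ A.a k)
  simp only [Category.assoc] at h1
  rw [Scheme.homOfLE_homOfLE_assoc] at h1
  rw [h1]
  change _ ≫ (A.transition i k).hom ≫ _ = _
  rw [A.transition_hom, Scheme.homOfLE_homOfLE_assoc]

/-- The cocycle of the changes of charts. -/
def cocycle : Cocycle (j ≫ ρ) n where
  J := A.J
  U := A.U
  iSup_U := A.iSup_U
  g := A.g
  cocycle i k l := by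
    -- After composition with the chart `a l`, a monomorphism, each transition only replaces one
    -- chart by another, so both sides become `a i`.
    rw [← cancel_mono (prodZ.incl (j ≫ ρ) n inf_le_right ≫ A.a l), Category.assoc]
    rw [A.g_res (le_inf (inf_le_left.trans inf_le_left) inf_le_right),
      A.g_res (le_inf (inf_le_left.trans inf_le_right) inf_le_right), A.g_res inf_le_left]

/-- The charts of the scheme obtained by gluing. -/
def chart (i : A.J) : prodZ.over (j ≫ ρ) n (A.U i) ⟶ A.cocycle.glued := A.cocycle.chart i

lemma chart_condition (i k : A.J) :
    prodZ.incl (j ≫ ρ) n (inf_le_left : A.U i ⊓ A.U k ≤ A.U i) ≫ A.chart i =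
      (A.transition i k).hom ≫ prodZ.incl (j ≫ ρ) n inf_le_right ≫ A.chart k :=
  A.cocycle.chart_condition i k

lemma exists_fromGlued : ∃ f : A.cocycle.glued ⟶ Y, ∀ i, A.chart i ≫ f = A.a i :=
  A.cocycle.exists_desc A.a fun i k => (A.transition_hom i k).symm

/-- The charts as an open cover of `Y`. -/
def cover (hj : Function.Surjective j) : Y.OpenCover :=
  Scheme.Cover.mkOfCovers A.J (fun i => prodZ.over (j ≫ ρ) n (A.U i)) (fun i => A.a i)
    (fun y => by
      obtain ⟨c, rfl⟩ := hj y
      have hc : c ∈ ⨆ i, A.U i := by rw [A.iSup_U]; trivial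
      obtain ⟨i, hi⟩ := TopologicalSpace.Opens.mem_iSup.mp hc
      have h1 := A.range_incl_a (le_refl (A.U i))
      obtain ⟨x, hx⟩ : j c ∈ Set.range (prodZ.incl (j ≫ ρ) n (le_refl (A.U i)) ≫ A.a i) := by
        rw [h1]; exact ⟨c, hi, rfl⟩
      exact ⟨i, _, hx⟩) (fun i => A.isOpenImmersion i)

/-- Injectivity of `j` identifies the intersection of the images of two charts with `j(U_i ∩ U_k)`.
The fibre product therefore factors through `(U_i ∩ U_k) × Z_n`, where compatibility is the gluing
condition. -/
lemma pullback_compat (hj : Function.Injective j) (i k : A.J) :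
    pullback.fst (A.a i) (A.a k) ≫ A.chart i =
      pullback.snd (A.a i) (A.a k) ≫ A.chart k := by
  have hr : Set.range (pullback.fst (A.a i) (A.a k)) ⊆
      Set.range (prodZ.incl (j ≫ ρ) n (inf_le_left : A.U i ⊓ A.U k ≤ A.U i)) := by
    rintro _ ⟨p, rfl⟩
    have h1 : A.a i (pullback.fst (A.a i) (A.a k) p) = A.a k (pullback.snd (A.a i) (A.a k) p) := by
      rw [← Scheme.Hom.comp_apply, pullback.condition, Scheme.Hom.comp_apply]
    have h2 : A.a i (pullback.fst (A.a i) (A.a k) p) ∈ j '' (A.U i ⊓ A.U k : C.Opens) := by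
      have hi := A.range_incl_a (le_refl (A.U i))
      have hk := A.range_incl_a (le_refl (A.U k))
      simp only [prodZ.incl, Scheme.homOfLE_rfl, Category.id_comp] at hi hk
      rw [TopologicalSpace.Opens.coe_inf, Set.image_inter hj]
      refine ⟨hi ▸ ⟨_, rfl⟩, ?_⟩
      rw [h1]
      exact hk ▸ ⟨_, rfl⟩
    rw [← A.range_incl_a inf_le_left] at h2
    obtain ⟨x, hx⟩ := h2
    refine ⟨x, (A.a i).injective ?_⟩
    rw [← hx, Scheme.Hom.comp_apply]
  obtain ⟨q, hq⟩ : ∃ q, q ≫ prodZ.incl (j ≫ ρ) n inf_le_left = pullback.fst (A.a i) (A.a k) :=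
    ⟨_, IsOpenImmersion.lift_fac _ _ hr⟩
  have h3 : q ≫ (A.transition i k).hom ≫ prodZ.incl (j ≫ ρ) n inf_le_right =
      pullback.snd (A.a i) (A.a k) := by
    rw [← cancel_mono (A.a k), Category.assoc, Category.assoc, A.transition_hom, reassoc_of% hq,
      pullback.condition]
  rw [← h3, ← hq, Category.assoc, A.chart_condition, Category.assoc, Category.assoc]

/-- The charts `a i` glue to a map from the glued scheme to `Y`. Since they also cover `Y`, the
gluing charts descend to a map back, and the two are inverse on each chart. -/
theorem isAbstractPrimitiveCurve (A : ChartFamily ρ j n) (hj : Function.Bijective j) :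
    IsAbstractPrimitiveCurve ρ j n := by
  obtain ⟨f, hf⟩ := A.exists_fromGlued
  obtain ⟨f', hf'⟩ : ∃ f' : Y ⟶ A.cocycle.glued, ∀ i, A.a i ≫ f' = A.chart i :=
    ⟨(A.cover hj.2).glueMorphisms A.chart (A.pullback_compat hj.1),
      (A.cover hj.2).ι_glueMorphisms A.chart (A.pullback_compat hj.1)⟩
  refine ⟨A.cocycle, ⟨f, f', ?_, ?_⟩, ?_, fun i => ?_⟩
  · refine A.cocycle.glued_hom_ext fun (i : A.J) => ?_
    change A.chart i ≫ f ≫ f' = A.chart i ≫ 𝟙 _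
    rw [reassoc_of% (hf i), hf', Category.comp_id]
  · refine Scheme.Cover.hom_ext (A.cover hj.2) _ _ fun (i : A.J) => ?_
    change A.a i ≫ f' ≫ f = A.a i ≫ 𝟙 _
    rw [reassoc_of% (hf' i), hf, Category.comp_id]
  · refine A.cocycle.glued_hom_ext fun (i : A.J) => ?_
    change A.chart i ≫ f ≫ ρ = A.cocycle.chart i ≫ A.cocycle.str
    rw [reassoc_of% (hf i), A.a_str]
    exact (A.cocycle.chart_str i).symm
  · have h (i : A.J) : prodZ.zeroOn (j ≫ ρ) n (A.U i) ≫ A.chart i ≫ f = Scheme.Opens.ι _ ≫ j := by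
      rw [hf, A.zeroOn_a]
    exact h i

end ChartFamily

end Gluing

/-! ### Rings of sections as `ℂ`-algebras -/

section Constants

variable {X Y C : Scheme.{0}} (ρ : Y ⟶ SpecC) (j : C ⟶ Y)

lemma le_preimage_top (V : Y.Opens) : V ≤ ρ ⁻¹ᵁ ⊤ := fun _ _ => trivial

/-- The structure homomorphism of the `ℂ`-algebra of sections over `V`. -/
def constants (V : Y.Opens) : CommRingCat.of ℂ ⟶ Γ(Y, V) :=
  (Scheme.ΓSpecIso (.of ℂ)).inv ≫ ρ.appLE ⊤ V (le_preimage_top ρ V)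

lemma constants_app (V : Y.Opens) :
    constants ρ V ≫ j.app V = constants (j ≫ ρ) (j ⁻¹ᵁ V) := by
  rw [constants, constants, Category.assoc, Scheme.Hom.app_eq_appLE,
    Scheme.Hom.appLE_comp_appLE]

lemma constants_germ (V : Y.Opens) (y : Y) (hy : y ∈ V) :
    constants ρ V ≫ Y.presheaf.germ V y hy =
      CommRingCat.ofHom (algebraMap ℂ (LocalRingAt ρ y)) := by
  change _ = (Scheme.ΓSpecIso (.of ℂ)).inv ≫ ρ.appTop ≫ Y.presheaf.germ ⊤ y _
  rw [constants, Category.assoc, Scheme.Hom.appLE, Category.assoc, Y.presheaf.germ_res]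
  rfl

lemma toSpecΓ_constants (V : Y.Opens) :
    V.toSpecΓ ≫ Spec.map (constants ρ V) = V.ι ≫ ρ := by
  rw [constants, Spec.map_comp, Scheme.Opens.toSpecΓ_SpecMap_appLE_assoc,
    Scheme.Opens.toSpecΓ_top, Category.assoc, toSpecΓ_SpecMap_ΓSpecIso_inv, Category.comp_id,
    Scheme.Hom.resLE_comp_ι]

lemma constants_smooth [Smooth ρ] {V : Y.Opens} (hV : IsAffineOpen V) :
    (constants ρ V).hom.Smooth := by
  rw [constants, CommRingCat.hom_comp]
  refine RingHom.Smooth.stableUnderComposition _ _ ?_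
    (Scheme.Hom.smooth_appLE ρ (isAffineOpen_top _) hV (le_preimage_top ρ V))
  exact RingHom.Smooth.of_bijective
    (ConcreteCategory.bijective_of_isIso (Scheme.ΓSpecIso (.of ℂ)).inv)

/-- Evaluation at `t = 0` as a homomorphism of `ℂ`-algebras. -/
def TruncPoly.evalZeroₐ (n : ℕ) [NeZero n] : TruncPoly n →ₐ[ℂ] ℂ :=
  { TruncPoly.evalZero n with
    commutes' := fun z => (Polynomial.eval_C (R := ℂ) (a := z) (x := 0) :) }

lemma TruncPoly.algHom_ext {A : Type*} [CommRing A] [Algebra ℂ A] {n : ℕ}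
    {g h : TruncPoly n →ₐ[ℂ] A} (H : g (TruncPoly.t n) = h (TruncPoly.t n)) : g = h :=
  Ideal.Quotient.algHom_ext _ (Polynomial.algHom_ext H)

lemma isPullback_SpecMap_truncPoly {A B : Type} [CommRing A] [CommRing B] [Algebra ℂ A]
    [Algebra ℂ B] {n : ℕ}
    (e : (A ⊗[ℂ] TruncPoly n) ≃ₐ[ℂ] B) :
    IsPullback
      (Spec.map (CommRingCat.ofHom (e.toAlgHom.comp Algebra.TensorProduct.includeLeft).toRingHom))
      (Spec.map (CommRingCat.ofHom (e.toAlgHom.comp Algebra.TensorProduct.includeRight).toRingHom))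
      (Spec.map (CommRingCat.ofHom (algebraMap ℂ A))) (Z.str n) := by
  refine isPullback_SpecMap_of_isPushout _ _ _ _ ?_
  refine (CommRingCat.isPushout_tensorProduct ℂ A (TruncPoly n)).of_iso (Iso.refl _) (Iso.refl _)
    (Iso.refl _) e.toRingEquiv.toCommRingCatIso ?_ ?_ ?_ ?_
  all_goals rfl

/-- The geometric form of `exists_tensor_truncPoly_equiv`: on an affine open the section `σ` exists
by smoothness of `C`, and gives a retraction of `V` onto `j ⁻¹ᵁ V`, the first projection of the
chart. -/
theorem exists_chart {n : ℕ} [NeZero n] {V : Y.Opens} (hV : IsAffineOpen V)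
    (hC : IsAffineOpen (j ⁻¹ᵁ V)) (hsurj : Function.Surjective (j.app V)) {f : Γ(Y, V)}
    (hf : IsTrunc f n) (hker : ∀ x, j.app V x = 0 ↔ f ∣ x) [Smooth (j ≫ ρ)] :
    ∃ e : V.toScheme ≅ prodZ ((j ⁻¹ᵁ V).ι ≫ j ≫ ρ) n,
      e.hom ≫ prodZ.str _ n = V.ι ≫ ρ ∧ (j ∣_ V) ≫ e.hom = prodZ.zero _ n := by
  let := (constants ρ V).hom.toAlgebra
  let := (constants (j ≫ ρ) (j ⁻¹ᵁ V)).hom.toAlgebra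
  let r : Γ(Y, V) →ₐ[ℂ] Γ(C, j ⁻¹ᵁ V) :=
    { (j.app V).hom with commutes' := fun z => congr($(constants_app ρ j V) z) }
  have hsm : Algebra.Smooth ℂ Γ(C, j ⁻¹ᵁ V) := constants_smooth (j ≫ ρ) hC
  have hnil := hf.isNilpotent_ker r.toRingHom hker
  let σ := Algebra.FormallySmooth.liftOfSurjective (AlgHom.id ℂ Γ(C, j ⁻¹ᵁ V)) r hsurj hnil
  have hσ (a) : r (σ a) = a := Algebra.FormallySmooth.liftOfSurjective_apply _ r hsurj hnil a
  obtain ⟨e, he, het⟩ := exists_tensor_truncPoly_equiv hf r hker σ hσ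
  have hsq := isPullback_SpecMap_truncPoly e
  set p := e.toAlgHom.comp Algebra.TensorProduct.includeLeft with hp
  set q := e.toAlgHom.comp Algebra.TensorProduct.includeRight with hq
  have hrp : r.comp p = AlgHom.id ℂ _ := AlgHom.ext fun a => by
    change r (e (a ⊗ₜ 1)) = a
    rw [he, hσ]
  have hsq' : IsPullback (V.toSpecΓ ≫ Spec.map (CommRingCat.ofHom p.toRingHom) ≫ hC.isoSpec.inv)
      (V.toSpecΓ ≫ Spec.map (CommRingCat.ofHom q.toRingHom)) ((j ⁻¹ᵁ V).ι ≫ j ≫ ρ) (Z.str n) := by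
    refine hsq.of_iso hV.isoSpec.symm hC.isoSpec.symm (Iso.refl _) (Iso.refl _) ?_ ?_ ?_ ?_
    · simp
    · simp
    · rw [← toSpecΓ_constants (j ≫ ρ)]
      simp
      rfl
    · simp
  have hj : (j ∣_ V) ≫ V.toSpecΓ = (j ⁻¹ᵁ V).toSpecΓ ≫ Spec.map (CommRingCat.ofHom r.toRingHom) := by
    have := Scheme.Opens.toSpecΓ_SpecMap_appLE j V (j ⁻¹ᵁ V) le_rfl
    rw [← Scheme.Hom.app_eq_appLE, Scheme.Hom.resLE_eq_morphismRestrict] at this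
    exact this.symm
  refine ⟨hsq'.isoPullback, ?_, ?_⟩
  · rw [prodZ.str, prodZ.fst, IsPullback.isoPullback_hom_fst_assoc, hsq'.w, Z.str,
      Category.assoc, ← Spec.map_comp, ← CommRingCat.ofHom_comp, ← toSpecΓ_constants]
    congr 3
    ext z
    exact q.commutes z
  · apply pullback.hom_ext
    · rw [Category.assoc, IsPullback.isoPullback_hom_fst, reassoc_of% hj, ← Spec.map_comp_assoc,
        prodZ.zero_fst]
      have : CommRingCat.ofHom p.toRingHom ≫ CommRingCat.ofHom r.toRingHom = 𝟙 _ := by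
        ext a
        exact congr($hrp a)
      rw [this, Spec.map_id]
      exact hC.toSpecΓ_isoSpec_inv
    · rw [Category.assoc, IsPullback.isoPullback_hom_snd, reassoc_of% hj, ← Spec.map_comp,
        prodZ.zero, pullback.lift_snd, ← toSpecΓ_constants, Z.zero, Category.assoc, ← Spec.map_comp]
      -- Both homomorphisms send `t` to zero, because `r f = 0`: restricting the chart to `C`
      -- amounts to setting `t = 0`.
      have : r.comp q = (Algebra.ofId ℂ _).comp (TruncPoly.evalZeroₐ n) := by
        refine TruncPoly.algHom_ext ?_
        change r (e (1 ⊗ₜ TruncPoly.t n)) = algebraMap ℂ _ (TruncPoly.evalZero n (TruncPoly.t n))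
        have h0 : TruncPoly.evalZero n (TruncPoly.t n) = 0 :=
          (Polynomial.eval_X (R := ℂ) (x := 0) :)
        rw [het, h0, map_zero]
        exact (hker f).mpr dvd_rfl
      have h2 : CommRingCat.ofHom q.toRingHom ≫ CommRingCat.ofHom r.toRingHom =
          CommRingCat.ofHom (TruncPoly.evalZero n) ≫ constants (j ≫ ρ) (j ⁻¹ᵁ V) :=
        CommRingCat.hom_ext (RingHom.ext fun x => congr($this x))
      rw [← h2]

end Constants

/-! ### Truncated parameters of local rings and of rings of sections -/

section Stalk

variable {C Y : Scheme.{0}} (j : C ⟶ Y) [IsClosedImmersion j] {V : Y.Opens} (hV : IsAffineOpen V)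
  (c : C) (hc : j c ∈ V)

include hV in
-- Both stalks are localizations along a single multiplicative subset of the sections of `Y` and its
-- image in those of `C`, which is the setting of the localization lemmas for `IsTrunc`.
lemma stalk_isLocalization :
    letI := Y.presheaf.algebra_section_stalk ⟨j c, hc⟩
    letI := C.presheaf.algebra_section_stalk (U := j ⁻¹ᵁ V) ⟨c, hc⟩
    IsLocalization (hV.primeIdealOf ⟨j c, hc⟩).asIdeal.primeCompl (Y.presheaf.stalk (j c)) ∧
      IsLocalization ((hV.primeIdealOf ⟨j c, hc⟩).asIdeal.primeCompl.map (j.app V).hom)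
        (C.presheaf.stalk c) := by
  let := Y.presheaf.algebra_section_stalk ⟨j c, hc⟩
  let := C.presheaf.algebra_section_stalk (U := j ⁻¹ᵁ V) ⟨c, hc⟩
  refine ⟨hV.isLocalization_stalk ⟨j c, hc⟩, ?_⟩
  have hC : IsAffineOpen (j ⁻¹ᵁ V) := hV.preimage j
  have h1 := hC.isLocalization_stalk ⟨c, hc⟩
  have h2 := IsAffineOpen.comap_primeIdealOf_appLE (f := j) V hV (j ⁻¹ᵁ V) hC le_rfl hc
  rw [← Scheme.Hom.app_eq_appLE] at h2
  have hsurj : Function.Surjective (j.app V) := j.app_surjective V hV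
  have h3 : (hV.primeIdealOf ⟨j c, hc⟩).asIdeal.primeCompl.map (j.app V).hom =
      (hC.primeIdealOf ⟨c, hc⟩).asIdeal.primeCompl := by
    rw [← h2]
    ext x
    constructor
    · rintro ⟨y, hy, rfl⟩
      exact hy
    · intro hx
      obtain ⟨y, rfl⟩ := hsurj x
      exact ⟨y, hx, rfl⟩
  rw [h3]
  exact h1

variable {n : ℕ}

include hV in
lemma IsTrunc.germ {f : Γ(Y, V)} (hf : IsTrunc f n) (hker : ∀ x, j.app V x = 0 ↔ f ∣ x) :
    IsTrunc (Y.presheaf.germ V (j c) hc f) n ∧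
      ∀ x, j.stalkMap c x = 0 ↔ Y.presheaf.germ V (j c) hc f ∣ x := by
  let := Y.presheaf.algebra_section_stalk ⟨j c, hc⟩
  let := C.presheaf.algebra_section_stalk (U := j ⁻¹ᵁ V) ⟨c, hc⟩
  obtain ⟨h1, h2⟩ := stalk_isLocalization j hV c hc
  constructor
  · exact IsTrunc.of_isLocalization (B' := Y.presheaf.stalk (j c))
      (hV.primeIdealOf ⟨j c, hc⟩).asIdeal.primeCompl
      ⟨1, one_mem _, by rw [one_mul, hf.pow_eq_zero]⟩
      fun i hi x hx => ⟨1, one_mem _, by rw [one_mul]; exact hf.dvd_of_dvd i hi x hx⟩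
  · refine map_eq_zero_iff_dvd_of_isLocalization (φ := (j.app V).hom) (j.stalkMap c).hom (fun x => ?_)
      (hV.primeIdealOf ⟨j c, hc⟩).asIdeal.primeCompl ((hker f).mpr dvd_rfl)
      fun x hx => ⟨1, one_mem _, by rw [one_mul]; exact (hker x).mp hx⟩
    exact Scheme.Hom.germ_stalkMap_apply j V c hc x

include hV hc in
-- Spreading out: by Noetherianity a parameter at one point is already a parameter on a principal
-- neighbourhood.
lemma exists_isTrunc_basicOpen [IsNoetherianRing Γ(Y, V)] {f' : Y.presheaf.stalk (j c)}
    (hf : IsTrunc f' n) (hker : ∀ x, j.stalkMap c x = 0 ↔ f' ∣ x) :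
    ∃ g : Γ(Y, V), j c ∈ Y.basicOpen g ∧ ∃ f : Γ(Y, Y.basicOpen g), IsTrunc f n ∧
      ∀ x, j.app (Y.basicOpen g) x = 0 ↔ f ∣ x := by
  let := Y.presheaf.algebra_section_stalk ⟨j c, hc⟩
  let := C.presheaf.algebra_section_stalk (U := j ⁻¹ᵁ V) ⟨c, hc⟩
  obtain ⟨h1, h2⟩ := stalk_isLocalization j hV c hc
  obtain ⟨g, hg, f, hf0, hfk, hfn, hfd⟩ := exists_of_isTrunc_localization (φ := (j.app V).hom)
    (j.stalkMap c).hom (fun x => Scheme.Hom.germ_stalkMap_apply j V c hc x)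
    (hV.primeIdealOf ⟨j c, hc⟩).asIdeal.primeCompl hf hker
  have hC : IsAffineOpen (j ⁻¹ᵁ V) := hV.preimage j
  have hgu : j c ∈ Y.basicOpen g := by
    rw [Scheme.mem_basicOpen _ _ _ hc]
    exact IsLocalization.map_units (Y.presheaf.stalk (j c))
      (⟨g, hg⟩ : (hV.primeIdealOf ⟨j c, hc⟩).asIdeal.primeCompl)
  have h3 : IsLocalization.Away g Γ(Y, Y.basicOpen g) := hV.isLocalization_basicOpen g
  let := (C.presheaf.map (homOfLE (j.preimage_mono (Y.basicOpen_le g))).op).hom.toAlgebra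
  have h4 : IsLocalization.Away (j.app V g) Γ(C, j ⁻¹ᵁ Y.basicOpen g) :=
    hC.isLocalization_of_eq_basicOpen (j.app V g) _ (Scheme.preimage_basicOpen j g)
  have h5 : IsLocalization ((Submonoid.powers g).map (j.app V).hom) Γ(C, j ⁻¹ᵁ Y.basicOpen g) := by
    rw [Submonoid.map_powers]
    exact h4
  refine ⟨g, hgu, algebraMap Γ(Y, V) _ f, ?_, ?_⟩
  · exact IsTrunc.of_isLocalization (B' := Γ(Y, Y.basicOpen g)) (Submonoid.powers g)
      ⟨g, Submonoid.mem_powers g, hfn⟩ fun i hi x hx => ⟨g, Submonoid.mem_powers g, hfd i hi x hx⟩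
  · refine map_eq_zero_iff_dvd_of_isLocalization (φ := (j.app V).hom) (j.app (Y.basicOpen g)).hom
      (fun x => ?_) (Submonoid.powers g) hf0 fun x hx => ⟨g, Submonoid.mem_powers g, hfk x hx⟩
    exact congr($(j.naturality (homOfLE (Y.basicOpen_le g)).op) x)

end Stalk

/-! ### Closed subschemes -/

section Closed

variable {X : Scheme.{0}} {π : X ⟶ SpecC} {I J : X.IdealSheafData}

lemma subschemeι_app_eq_zero_iff (U : X.affineOpens) (x : Γ(X, U.1)) :
    I.subschemeι.app U.1 x = 0 ↔ x ∈ I.ideal U := by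
  rw [← I.ker_subschemeι_app U]
  rfl

lemma inclusion_app_eq_zero_iff (h : I ≤ J) (U : X.affineOpens) (x : Γ(X, U.1)) :
    (Scheme.IdealSheafData.inclusion h).app (I.subschemeι ⁻¹ᵁ U.1) (I.subschemeι.app U.1 x) = 0 ↔
      x ∈ J.ideal U := by
  have key : ∀ (g : J.subscheme ⟶ X), g = J.subschemeι → (g.app U.1 x = 0 ↔ x ∈ J.ideal U) := by
    rintro _ rfl
    exact subschemeι_app_eq_zero_iff U x
  have := key (Scheme.IdealSheafData.inclusion h ≫ I.subschemeι)
    (Scheme.IdealSheafData.inclusion_subschemeι h)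
  rw [← this, Scheme.Hom.comp_app]
  rfl

lemma thickening_isTrunc (n : ℕ) [NeZero n] (U : X.affineOpens) {f : Γ(X, U.1)}
    (hf : f ∈ nonZeroDivisors Γ(X, U.1)) (hI : I.ideal U = Ideal.span {f}) :
    IsTrunc ((I ^ n).subschemeι.app U.1 f) n ∧
      ∀ x, (thickIncl I n).app ((I ^ n).subschemeι ⁻¹ᵁ U.1) x = 0 ↔
        (I ^ n).subschemeι.app U.1 f ∣ x := by
  have hIn : (I ^ n).ideal U = Ideal.span {f ^ n} := by
    rw [Scheme.IdealSheafData.ideal_pow, Pi.pow_apply, hI, Ideal.span_singleton_pow]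
  have hdvd (g x : Γ(X, U.1)) (hg : g ∣ f ^ n)
      -- Divisibility by a divisor `g` of `f^n` can be tested before reducing modulo `f^n`. It is
      -- used for `g = f^(i+1)` with `i < n`, after which the nonzerodivisor `f^i` cancels, and for
      -- `g = f`.
      (h : (I ^ n).subschemeι.app U.1 g ∣ (I ^ n).subschemeι.app U.1 x) : g ∣ x := by
    obtain ⟨y, hy⟩ := h
    obtain ⟨y, rfl⟩ := (I ^ n).subschemeι_app_surjective U y
    have h1 : x - g * y ∈ (I ^ n).ideal U := by
      rw [← subschemeι_app_eq_zero_iff, map_sub, map_mul, ← hy, sub_self]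
    rw [hIn, Ideal.mem_span_singleton] at h1
    have := dvd_add (hg.trans h1) (dvd_mul_right g y)
    rwa [sub_add_cancel] at this
  refine ⟨⟨?_, fun i hi x hx => ?_⟩, fun x => ?_⟩
  · rw [← map_pow, subschemeι_app_eq_zero_iff, hIn]
    exact Ideal.mem_span_singleton_self _
  · obtain ⟨x, rfl⟩ := (I ^ n).subschemeι_app_surjective U x
    rw [← map_pow, ← map_pow, ← map_mul] at hx
    obtain ⟨y, hy⟩ := hdvd _ _ (pow_dvd_pow f hi) hx
    refine map_dvd _ ⟨y, ?_⟩
    have h1 : f ^ i ∈ nonZeroDivisors Γ(X, U.1) := pow_mem hf i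
    rw [← mul_cancel_left_mem_nonZeroDivisors h1, hy, Nat.succ_eq_add_one]
    ring
  · obtain ⟨x, rfl⟩ := (I ^ n).subschemeι_app_surjective U x
    rw [inclusion_app_eq_zero_iff, hI, Ideal.mem_span_singleton]
    refine ⟨fun h => map_dvd _ h, fun h => hdvd _ _ (dvd_pow_self f (NeZero.ne n)) h⟩

lemma localRing_formallySmooth {Y : Scheme.{0}} (ρ : Y ⟶ SpecC) [Smooth ρ] (y : Y) :
    Algebra.FormallySmooth ℂ (LocalRingAt ρ y) := by
  obtain ⟨_, ⟨V, hV, rfl⟩, hy, -⟩ := Y.isBasis_affineOpens.exists_subset_of_mem_open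
    (Set.mem_univ y) isOpen_univ
  rw [← RingHom.formallySmooth_algebraMap]
  have h1 : algebraMap ℂ (LocalRingAt ρ y) =
      (Y.presheaf.germ V y hy).hom.comp (constants ρ V).hom := by
    have := congrArg CommRingCat.Hom.hom (constants_germ ρ V y hy)
    exact this.symm
  rw [h1]
  refine RingHom.FormallySmooth.comp (constants_smooth ρ hV).formallySmooth ?_
  let := Y.presheaf.algebra_section_stalk ⟨y, hy⟩
  have := hV.isLocalization_stalk ⟨y, hy⟩
  have h2 : Algebra.FormallySmooth Γ(Y, V) (Y.presheaf.stalk y) :=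
    Algebra.FormallySmooth.of_isLocalization (hV.primeIdealOf ⟨y, hy⟩).asIdeal.primeCompl
  exact RingHom.formallySmooth_algebraMap.mpr h2

theorem hypersurface_thickening (hI : IsSmoothHypersurface π I) (n : ℕ) [NeZero n]
    (P : I.subscheme) :
    (∃ σ : LocalRingAt (subStr π I) P →ₐ[ℂ] LocalRingAt (subStr π (I ^ n)) (thickIncl I n P),
      ∀ a, restriction π I n P (σ a) = a) ∧
    (∀ σ : LocalRingAt (subStr π I) P →ₐ[ℂ] LocalRingAt (subStr π (I ^ n)) (thickIncl I n P),
      (∀ a, restriction π I n P (σ a) = a) →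
      ∃ e : (LocalRingAt (subStr π I) P ⊗[ℂ] TruncPoly n) ≃ₐ[ℂ]
          LocalRingAt (subStr π (I ^ n)) (thickIncl I n P),
        (∀ a, e (a ⊗ₜ 1) = σ a) ∧ restriction π I n P (e (1 ⊗ₜ TruncPoly.t n)) = 0) ∧
    (∃ V : (I ^ n).subscheme.Opens, thickIncl I n P ∈ V ∧
      ∃ e : V.toScheme ≅ prodZ ((thickIncl I n ⁻¹ᵁ V).ι ≫ subStr π I) n,
        e.hom ≫ prodZ.str _ n = V.ι ≫ subStr π (I ^ n) ∧
        (thickIncl I n ∣_ V) ≫ e.hom = prodZ.zero _ n) := by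
  obtain ⟨U, f, hPU, hf, hfI⟩ := hI.local_equation (I.subschemeι P)
  obtain ⟨hft, hfker⟩ := thickening_isTrunc n U hf hfI
  have hV : IsAffineOpen ((I ^ n).subschemeι ⁻¹ᵁ U.1) := U.2.preimage _
  have hP : thickIncl I n P ∈ (I ^ n).subschemeι ⁻¹ᵁ U.1 := by
    change ((I ^ n).subschemeι (thickIncl I n P)) ∈ U.1
    rw [← Scheme.Hom.comp_apply, Scheme.IdealSheafData.inclusion_subschemeι]
    exact hPU
  obtain ⟨F, hst, hker⟩ : ∃ F : LocalRingAt (subStr π (I ^ n)) (thickIncl I n P), IsTrunc F n ∧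
      ∀ x, restriction π I n P x = 0 ↔ F ∣ x :=
    ⟨_, IsTrunc.germ (thickIncl I n) hV P hP hft hfker⟩
  have := hI.smooth
  have hfs := localRing_formallySmooth (subStr π I) P
  refine ⟨?_, fun σ hσ => ?_, ?_⟩
  · have hsurj : Function.Surjective (restriction π I n P) := (thickIncl I n).stalkMap_surjective P
    have hnil := hst.isNilpotent_ker (restriction π I n P).toRingHom hker
    exact ⟨Algebra.FormallySmooth.liftOfSurjective (AlgHom.id ℂ _) _ hsurj hnil,
      Algebra.FormallySmooth.liftOfSurjective_apply _ _ hsurj hnil⟩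
  · obtain ⟨e, he, het⟩ := exists_tensor_truncPoly_equiv hst (restriction π I n P) hker σ hσ
    exact ⟨e, he, by rw [het]; exact (hker _).mpr dvd_rfl⟩
  · refine ⟨_, hP, ?_⟩
    have hstr : thickIncl I n ≫ subStr π (I ^ n) = subStr π I := by simp
    have : Smooth (thickIncl I n ≫ subStr π (I ^ n)) := by rwa [hstr]
    have := exists_chart (subStr π (I ^ n)) (thickIncl I n) hV (hV.preimage _)
      ((thickIncl I n).app_surjective _ hV) hft hfker
    rw [hstr] at this
    exact this

end Closed

/-! ### Local rings of smooth schemes -/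

theorem exists_maximalIdeal_eq_span_of_smoothOfRelativeDimension {Y : Scheme.{0}} {ρ : Y ⟶ SpecC}
    {d : ℕ} (hρ : SmoothOfRelativeDimension d ρ) {y : Y} (hy : IsClosed {y}) :
    ∃ x : Fin d → Y.presheaf.stalk y,
      IsLocalRing.maximalIdeal (Y.presheaf.stalk y) = Ideal.span (Set.range x) ∧
        ∀ i, IsSMulRegular (Y.presheaf.stalk y) (x i) := by
  obtain ⟨U, hU, V, hV, hyV, e, h⟩ := hρ.exists_isStandardSmoothOfRelativeDimension y
  obtain rfl : U = ⊤ := by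
    refine top_le_iff.mp fun z _ => ?_
    have : ρ y = z := Subsingleton.elim (α := PrimeSpectrum ℂ) _ _
    exact this ▸ e hyV
  have h1 : ((Scheme.ΓSpecIso (.of ℂ)).inv ≫ ρ.appLE ⊤ V e).hom.IsStandardSmoothOfRelativeDimension d :=
    (RingHom.isStandardSmoothOfRelativeDimension_respectsIso (n := d)).2 (ρ.appLE ⊤ V e).hom
      (Scheme.ΓSpecIso (.of ℂ)).symm.commRingCatIsoToRingEquiv h
  let := Y.presheaf.algebra_section_stalk ⟨y, hyV⟩
  have h2 := hV.isLocalization_stalk ⟨y, hyV⟩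
  have h3 := hV.primeIdealOf_isMaximal_of_isClosed ⟨y, hyV⟩ hy
  exact exists_maximalIdeal_eq_span_of_isStandardSmooth h1 (hV.primeIdealOf ⟨y, hyV⟩).asIdeal
    (Y.presheaf.stalk y)

lemma maximalIdeal_eq_span_of_surjective {ι : Type*} {A B : Type*} [CommRing A] [CommRing B]
    [IsLocalRing A] [IsLocalRing B] (φ : A →+* B) (hφ : Function.Surjective φ) {x : ι → A}
    (hx : IsLocalRing.maximalIdeal A = Ideal.span (Set.range x)) :
    IsLocalRing.maximalIdeal B = Ideal.span (Set.range (φ ∘ x)) := by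
  have := hφ.isLocalHom
  rw [Set.range_comp, ← Ideal.map_span, ← hx]
  refine le_antisymm (fun b hb => ?_) (((IsLocalRing.local_hom_TFAE φ).out 0 2).mp this)
  obtain ⟨a, rfl⟩ := hφ b
  refine Ideal.mem_map_of_mem φ ?_
  rw [IsLocalRing.mem_maximalIdeal, mem_nonunits_iff] at hb ⊢
  exact fun h => hb (h.map φ)

/-- The kernel condition makes `B` a quotient of `A`. It is applied with `R`, `A`, `B` the local
rings of the ambient variety, the surface and the curve. -/
lemma exists_maximalIdeal_eq_span_of_ker_le {ι : Type*} {R A B : Type*} [CommRing R] [CommRing A]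
    [CommRing B] [IsLocalRing A] [IsLocalRing B] {α : R →+* A} (hα : Function.Surjective α)
    {β : R →+* B} (hβ : Function.Surjective β) (h : ∀ a, α a = 0 → β a = 0) {x : ι → A}
    (hx : IsLocalRing.maximalIdeal A = Ideal.span (Set.range x)) :
    ∃ y : ι → B, IsLocalRing.maximalIdeal B = Ideal.span (Set.range y) := by
  let γ : A →+* B := α.liftOfSurjective hα ⟨β, h⟩
  have hγ : Function.Surjective γ := fun b => by
    obtain ⟨a, rfl⟩ := hβ b
    exact ⟨α a, α.liftOfRightInverse_comp_apply _ (Function.rightInverse_surjInv hα) ⟨β, h⟩ a⟩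
  exact ⟨_, maximalIdeal_eq_span_of_surjective γ hγ hx⟩

theorem exists_maximalIdeal_eq_span_of_smoothOfRelativeDimension_restrict {Y : Scheme.{0}}
    {ρ : Y ⟶ SpecC} {d : ℕ} {O : Y.Opens} (hρ : SmoothOfRelativeDimension d (O.ι ≫ ρ)) {y : Y}
    (hyO : y ∈ O)
    (hy : IsClosed {y}) :
    ∃ x : Fin d → Y.presheaf.stalk y,
      IsLocalRing.maximalIdeal (Y.presheaf.stalk y) = Ideal.span (Set.range x) := by
  obtain ⟨z, rfl⟩ : ∃ z : O.toScheme, O.ι z = y := ⟨⟨y, hyO⟩, rfl⟩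
  have hz : IsClosed {z} := by
    have := hy.preimage O.ι.continuous
    rwa [← Set.image_singleton, Set.preimage_image_eq _ O.ι.isOpenEmbedding.injective] at this
  obtain ⟨x, hx, -⟩ := exists_maximalIdeal_eq_span_of_smoothOfRelativeDimension hρ hz
  let e := (asIso (O.ι.stalkMap z)).symm.commRingCatIsoToRingEquiv
  exact ⟨_, maximalIdeal_eq_span_of_surjective e.toRingHom e.surjective hx⟩

/-- A representative of the germ vanishes on a neighbourhood of `c` in `C`; since `j` is a
topological embedding, this neighbourhood contains the trace of an affine open of `Y`. -/
lemma exists_app_eq_zero_of_stalkMap_eq_zero {C Y : Scheme.{0}} (j : C ⟶ Y) [IsClosedImmersion j]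
    (c : C) {W : Y.Opens} (hW : j c ∈ W) {a : Y.presheaf.stalk (j c)} (ha : j.stalkMap c a = 0) :
    ∃ (V : Y.Opens) (hc : j c ∈ V) (t : Γ(Y, V)), IsAffineOpen V ∧ V ≤ W ∧
      Y.presheaf.germ V (j c) hc t = a ∧ j.app V t = 0 := by
  obtain ⟨U, hcU, t, rfl⟩ := Y.presheaf.exists_germ_eq a
  have h1 : C.presheaf.germ (j ⁻¹ᵁ U) c hcU (j.app U t) = 0 := by
    rw [← ha, Scheme.Hom.germ_stalkMap_apply]
  rw [← map_zero (C.presheaf.germ (j ⁻¹ᵁ U) c hcU).hom] at h1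
  obtain ⟨O, hcO, i₁, i₂, h2⟩ := C.presheaf.germ_eq c hcU hcU _ _ h1
  obtain ⟨O', hO', hO⟩ := j.isClosedEmbedding.isInducing.isOpen_iff.mp O.2
  have hcO' : j c ∈ O' := by
    have : c ∈ j ⁻¹' O' := by rw [hO]; exact hcO
    exact this
  obtain ⟨_, ⟨V, hV, rfl⟩, hcV, hVle⟩ := Y.isBasis_affineOpens.exists_subset_of_mem_open
    (a := j c) (u := O' ∩ (U ⊓ W : Y.Opens)) ⟨hcO', hcU, hW⟩ (hO'.inter (U ⊓ W).2)
  have hVU : V ≤ U := fun z hz => (hVle hz).2.1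
  have hVO : j ⁻¹ᵁ V ≤ O := fun z hz => by
    have : z ∈ j ⁻¹' O' := (hVle hz).1
    rwa [hO] at this
  refine ⟨V, hcV, Y.presheaf.map (homOfLE hVU).op t, hV, fun z hz => (hVle hz).2.2,
    Y.presheaf.germ_res_apply (homOfLE hVU) _ hcV t, ?_⟩
  have h4 := congr($(j.naturality (homOfLE hVU).op) t)
  have h5 := congr(C.presheaf.map (homOfLE hVO).op $h2)
  simp only [map_zero] at h5
  refine h4.trans (Eq.trans ?_ h5)
  rw [← ConcreteCategory.comp_apply, ← Functor.map_comp]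
  rfl

/-- A section vanishing on `C` has empty nonvanishing locus in `Y`, as `j` is surjective, so it is
nilpotent on an affine open. -/
lemma isNilpotent_of_stalkMap_eq_zero {C Y : Scheme.{0}} (j : C ⟶ Y) [IsClosedImmersion j]
    (hj : Function.Surjective j) (c : C) {a : Y.presheaf.stalk (j c)} (ha : j.stalkMap c a = 0) :
    IsNilpotent a := by
  obtain ⟨V, hc, t, hV, -, rfl, ht⟩ :=
    exists_app_eq_zero_of_stalkMap_eq_zero j c (W := ⊤) trivial ha
  refine IsNilpotent.map ?_ (Y.presheaf.germ V (j c) hc).hom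
  rw [Scheme.isNilpotent_iff_basicOpen_eq_bot_of_isCompact hV.isCompact]
  refine eq_bot_iff.mpr fun y hy => ?_
  obtain ⟨z, rfl⟩ := hj y
  have h1 : z ∈ j ⁻¹ᵁ Y.basicOpen t := hy
  rw [Scheme.preimage_basicOpen, ht, Scheme.basicOpen_zero] at h1
  exact h1.elim

section Surface

variable {X : Scheme.{0}} {π : X ⟶ SpecC} {I J : X.IdealSheafData} {W : X.Opens}

/-- The inclusion of ideals, known only on affine opens inside `W`, passes to germs: the local ring
of `Y` becomes a quotient of that of the surface. -/
lemma stalkMap_eq_zero_of_le (hJI : ∀ V : X.affineOpens, V.1 ≤ W → J.ideal V ≤ I.ideal V)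
    (y : I.subscheme) (s : J.subscheme) (hys : I.subschemeι y = J.subschemeι s)
    (hy : I.subschemeι y ∈ W) (a : X.presheaf.stalk (I.subschemeι y))
    (ha : J.subschemeι.stalkMap s (X.presheaf.stalkSpecializes (specializes_of_eq hys.symm) a) = 0) :
    I.subschemeι.stalkMap y a = 0 := by
  obtain ⟨V, hsV, t, hV, hVW, hta, ht⟩ :=
    exists_app_eq_zero_of_stalkMap_eq_zero J.subschemeι s (W := W) (hys ▸ hy) ha
  have hyV : I.subschemeι y ∈ V := hys ▸ hsV
  have h1 : X.presheaf.germ V _ hyV t = a := by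
    refine (X.presheaf.stalkCongr (.of_eq hys)).commRingCatIsoToRingEquiv.injective
      (Eq.trans ?_ hta)
    exact X.presheaf.germ_stalkSpecializes_apply _ (specializes_of_eq hys.symm) t
  have h2 := (subschemeι_app_eq_zero_iff ⟨V, hV⟩ _).mpr
    (hJI ⟨V, hV⟩ hVW ((subschemeι_app_eq_zero_iff ⟨V, hV⟩ t).mp ht))
  rw [← h1, Scheme.Hom.germ_stalkMap_apply, h2, map_zero]

/-- The local ring of `Y` at a closed point near which `Y` lies on a smooth surface. -/
theorem exists_maximalIdeal_eq_span_pair {y : I.subscheme} (hcl : IsClosed {I.subschemeι y})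
    (hy : I.subschemeι y ∈ W)
    (hsm : SmoothOfRelativeDimension 2 ((J.subschemeι ⁻¹ᵁ W).ι ≫ subStr π J))
    (hJI : ∀ V : X.affineOpens, V.1 ≤ W → J.ideal V ≤ I.ideal V) :
    ∃ u v : I.subscheme.presheaf.stalk y,
      IsLocalRing.maximalIdeal (I.subscheme.presheaf.stalk y) = Ideal.span {u, v} := by
  -- The point lies on the surface because `J ≤ I` near it reverses to an inclusion of zero loci.
  obtain ⟨s, hs⟩ : ∃ s : J.subscheme, J.subschemeι s = I.subschemeι y := by
    change I.subschemeι y ∈ Set.range J.subschemeι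
    rw [J.range_subschemeι]
    obtain ⟨_, ⟨V, hV, rfl⟩, hyV, hVle⟩ := X.isBasis_affineOpens.exists_subset_of_mem_open hy W.2
    have h1 : I.subschemeι y ∈ I.support := by
      have : I.subschemeι y ∈ Set.range I.subschemeι := ⟨y, rfl⟩
      rwa [I.range_subschemeι] at this
    change I.subschemeι y ∈ J.support
    rw [Scheme.IdealSheafData.mem_support_iff_of_mem (U := ⟨V, hV⟩) hyV] at h1 ⊢
    exact X.zeroLocus_mono (hJI ⟨V, hV⟩ hVle) h1
  have hscl : IsClosed {s} := by
    have := hcl.preimage J.subschemeι.continuous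
    rwa [← hs, ← Set.image_singleton,
      Set.preimage_image_eq _ J.subschemeι.isClosedEmbedding.injective] at this
  obtain ⟨x, hx⟩ := exists_maximalIdeal_eq_span_of_smoothOfRelativeDimension_restrict hsm
    (y := s) (by change J.subschemeι s ∈ W; rwa [hs]) hscl
  have hα : Function.Surjective ((J.subschemeι.stalkMap s).hom.comp
      (X.presheaf.stalkSpecializes (specializes_of_eq hs)).hom) :=
    (J.subschemeι.stalkMap_surjective s).comp
      (X.presheaf.stalkCongr (.of_eq hs.symm)).commRingCatIsoToRingEquiv.surjective
  obtain ⟨x', hx'⟩ := exists_maximalIdeal_eq_span_of_ker_le hα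
    (β := (I.subschemeι.stalkMap y).hom) (I.subschemeι.stalkMap_surjective y)
    (fun a ha => stalkMap_eq_zero_of_le hJI y s hs.symm hy a ha) hx
  refine ⟨x' 0, x' 1, ?_⟩
  rw [hx']
  congr 1
  ext z
  simp [eq_comm]

end Surface

/-! ### Primitive multiple curves -/

/-- If `f^k = 0` with `k < n`, then `f^(k+1)` divides `f^k · 1`, so `f` divides `1`. Thus `n` is the
exact nilpotency order of `f`. -/
lemma IsTrunc.le_of_pow_eq_zero {B : Type*} [CommRing B] {f : B} {n k : ℕ} (hf : IsTrunc f n)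
    (hu : ¬IsUnit f) (hk : f ^ k = 0) : n ≤ k := by
  by_contra! h
  refine hu (isUnit_of_dvd_one (hf.dvd_of_dvd k h 1 ?_))
  rw [hk, zero_mul]
  exact dvd_zero _

lemma eq_zero_of_forall_germ_eq_zero {Y : Scheme.{0}} {V : Y.Opens} {s : Γ(Y, V)}
    (h : ∀ y (hy : y ∈ V), Y.presheaf.germ V y hy s = 0) : s = 0 :=
  TopCat.Presheaf.section_ext Y.sheaf V s 0 fun y hy =>
    (h y hy).trans (map_zero (Y.presheaf.germ V y hy).hom).symm

lemma not_isUnit_of_app_eq_zero {C Y : Scheme.{0}} (j : C ⟶ Y) {V : Y.Opens} {c : C} (hc : j c ∈ V)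
    {f : Γ(Y, V)} (hf : j.app V f = 0) : ¬IsUnit f := by
  intro hu
  have h := hu.map ((j.app V) ≫ C.presheaf.germ (j ⁻¹ᵁ V) c hc).hom
  rw [CommRingCat.hom_comp, RingHom.comp_apply, show (j.app V).hom f = 0 from hf, map_zero] at h
  exact not_isUnit_zero h

section Chart

variable {C Y : Scheme.{0}} (n : ℕ)

/-- Compares two models of `U × Z_n`: the open subscheme of `C × Z_n` used in cocycles, and the
fibre product produced by `exists_chart`. -/
lemma prodZ.isPullback_over (π : C ⟶ SpecC) (U : C.Opens) :
    IsPullback (prodZ.fst π n ∣_ U) (Scheme.Opens.ι _ ≫ pullback.snd π (Z.str n)) (U.ι ≫ π)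
      (Z.str n) :=
  ((isPullback_morphismRestrict (prodZ.fst π n) U).flip.paste_horiz
    (IsPullback.of_hasPullback π (Z.str n)).flip).flip

lemma prodZ.zero_snd [NeZero n] (π : C ⟶ SpecC) :
    prodZ.zero π n ≫ pullback.snd π (Z.str n) = π ≫ Z.zero n := pullback.lift_snd _ _ _

lemma prodZ.zeroOn_isoPullback [NeZero n] (π : C ⟶ SpecC) (U : C.Opens) :
    prodZ.zeroOn π n U ≫ (prodZ.isPullback_over n π U).isoPullback.hom =
      C.homOfLE (prodZ.zero_preimage U).le ≫ prodZ.zero (U.ι ≫ π) n := by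
  apply pullback.hom_ext
  · rw [Category.assoc, IsPullback.isoPullback_hom_fst, Category.assoc, prodZ.zero_fst,
      Category.comp_id, ← cancel_mono U.ι, Category.assoc, morphismRestrict_ι,
      morphismRestrict_ι_assoc, prodZ.zero_fst, Category.comp_id, Scheme.homOfLE_ι]
  · rw [Category.assoc, IsPullback.isoPullback_hom_snd, morphismRestrict_ι_assoc,
      prodZ.zero_snd, Category.assoc, prodZ.zero_snd, Category.assoc, Scheme.homOfLE_ι_assoc]

theorem isAbstractPrimitiveCurve_of_charts [NeZero n] {ρ : Y ⟶ SpecC} {j : C ⟶ Y}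
    (hj : Function.Bijective j)
    (h : ∀ c : C, ∃ V : Y.Opens, j c ∈ V ∧
      ∃ e : V.toScheme ≅ prodZ ((j ⁻¹ᵁ V).ι ≫ j ≫ ρ) n,
        e.hom ≫ prodZ.str _ n = V.ι ≫ ρ ∧ (j ∣_ V) ≫ e.hom = prodZ.zero _ n) :
    IsAbstractPrimitiveCurve ρ j n := by
  choose V hV e he he0 using h
  let A : ChartFamily ρ j n :=
    { J := C
      U := fun c => j ⁻¹ᵁ V c
      iSup_U := top_le_iff.mp fun c _ => TopologicalSpace.Opens.mem_iSup.mpr ⟨c, hV c⟩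
      a := fun c => (prodZ.isPullback_over n (j ≫ ρ) (j ⁻¹ᵁ V c)).isoPullback.hom ≫ (e c).inv ≫
        (V c).ι
      isOpenImmersion := fun c => inferInstance
      a_str := fun c => by
        rw [Category.assoc, Category.assoc, ← he c, Iso.inv_hom_id_assoc,
          IsPullback.isoPullback_hom_fst_assoc, morphismRestrict_ι_assoc]
      zeroOn_a := fun c => by
        rw [← Category.assoc, prodZ.zeroOn_isoPullback, Category.assoc, ← he0 c, Category.assoc,
          Iso.hom_inv_id_assoc, morphismRestrict_ι, Scheme.homOfLE_ι_assoc] }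
  exact A.isAbstractPrimitiveCurve hj

end Chart

section Reduced

variable {X : Scheme.{0}} {π : X ⟶ SpecC} {I : X.IdealSheafData}

/-- The closed immersion `C = Y_red → Y`, where `Y` is defined by `I`. -/
abbrev redIncl (I : X.IdealSheafData) : I.radical.subscheme ⟶ I.subscheme :=
  Scheme.IdealSheafData.inclusion I.le_radical

lemma redIncl_subStr : redIncl I ≫ subStr π I = subStr π I.radical := by simp

lemma redIncl_bijective : Function.Bijective (redIncl I) := by
  refine ⟨(redIncl I).isClosedEmbedding.injective, fun y => ?_⟩
  have h1 : I.subschemeι y ∈ Set.range I.radical.subschemeι := by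
    have : I.subschemeι y ∈ Set.range I.subschemeι := ⟨y, rfl⟩
    rw [I.range_subschemeι] at this
    rwa [I.radical.range_subschemeι, Scheme.IdealSheafData.support_radical]
  obtain ⟨c, hc⟩ := h1
  refine ⟨c, I.subschemeι.isClosedEmbedding.injective ?_⟩
  rw [← hc, ← Scheme.Hom.comp_apply, Scheme.IdealSheafData.inclusion_subschemeι]

/-- On the affine open subset `U`, the curve `Y` is of multiplicity `n` and `C` is given in `Y` by
one equation. -/
def HasParameter (I : X.IdealSheafData) (U : X.affineOpens) (n : ℕ) : Prop :=
  ∃ f : Γ(I.subscheme, I.subschemeι ⁻¹ᵁ U.1), IsTrunc f n ∧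
    ∀ x, (redIncl I).app (I.subschemeι ⁻¹ᵁ U.1) x = 0 ↔ f ∣ x

lemma mem_of_redIncl {c : I.radical.subscheme} {V : X.Opens} (hc : I.radical.subschemeι c ∈ V) :
    redIncl I c ∈ I.subschemeι ⁻¹ᵁ V := by
  change (I.subschemeι (redIncl I c)) ∈ V
  rwa [← Scheme.Hom.comp_apply, Scheme.IdealSheafData.inclusion_subschemeι]

lemma HasParameter.exists_stalk {U : X.affineOpens} {n : ℕ} (h : HasParameter I U n)
    (c : I.radical.subscheme) (hc : I.radical.subschemeι c ∈ U.1) :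
    ∃ F : I.subscheme.presheaf.stalk (redIncl I c), IsTrunc F n ∧
      ∀ x, (redIncl I).stalkMap c x = 0 ↔ F ∣ x := by
  obtain ⟨f, hf, hk⟩ := h
  exact ⟨_, IsTrunc.germ (redIncl I) (U.2.preimage _) c (mem_of_redIncl hc) hf hk⟩

/-- At a common point both parameters generate the kernel of restriction to `C`, so each is a
multiple of the other and they have the same nilpotency order. -/
lemma HasParameter.le {U V : X.affineOpens} {n m : ℕ} (hU : HasParameter I U n)
    (hV : HasParameter I V m) {c : I.radical.subscheme} (hcU : I.radical.subschemeι c ∈ U.1)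
    (hcV : I.radical.subschemeι c ∈ V.1) : n ≤ m := by
  obtain ⟨F, hF, hFk⟩ := hU.exists_stalk c hcU
  obtain ⟨G, hG, hGk⟩ := hV.exists_stalk c hcV
  refine hF.le_of_pow_eq_zero (fun h => ?_) (k := m) ?_
  · have := h.map ((redIncl I).stalkMap c).hom
    rw [show ((redIncl I).stalkMap c).hom F = 0 from (hFk F).mpr dvd_rfl] at this
    exact not_isUnit_zero this
  · obtain ⟨z, rfl⟩ := (hGk F).mp ((hFk F).mpr dvd_rfl)
    rw [mul_pow, hG.pow_eq_zero, zero_mul]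

lemma HasParameter.eq {U V : X.affineOpens} {n m : ℕ} (hU : HasParameter I U n)
    (hV : HasParameter I V m) {c : I.radical.subscheme} (hcU : I.radical.subschemeι c ∈ U.1)
    (hcV : I.radical.subschemeι c ∈ V.1) : n = m :=
  (hU.le hV hcU hcV).antisymm (hV.le hU hcV hcU)

/-- Local structure of primitive multiple curves at closed points. -/
theorem exists_hasParameter_of_isClosed (hX : IsSmoothVariety π)
    (hI : IsPrimitiveMultipleCurve π I) {c : I.radical.subscheme}
    (hc : IsClosed {c}) :
    ∃ n ≠ 0, ∃ U : X.affineOpens, I.radical.subschemeι c ∈ U.1 ∧ HasParameter I U n := by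
  obtain ⟨x, hx, hxr⟩ := exists_maximalIdeal_eq_span_of_smoothOfRelativeDimension hI.smooth hc
  have hxy : I.subschemeι (redIncl I c) = I.radical.subschemeι c := by
    rw [← Scheme.Hom.comp_apply, Scheme.IdealSheafData.inclusion_subschemeι]
  have hcl : IsClosed {I.subschemeι (redIncl I c)} := by
    rw [hxy, ← Set.image_singleton]
    exact I.radical.subschemeι.isClosedEmbedding.isClosedMap _ hc
  have hmem : I.subschemeι (redIncl I c) ∈ I.support := by
    have : I.subschemeι (redIncl I c) ∈ Set.range I.subschemeι := ⟨_, rfl⟩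
    rwa [I.range_subschemeι] at this
  obtain ⟨J, W, hcW, hsm, hJI⟩ := hI.surface _ hmem hcl
  obtain ⟨u, v, huv⟩ := exists_maximalIdeal_eq_span_pair hcl hcW hsm hJI
  have hCM := hI.cohenMacaulay (redIncl I c)
  have := hCM.1
  have hφ : Function.Surjective ((redIncl I).stalkMap c).hom := (redIncl I).stalkMap_surjective c
  -- The uniformizer of `C` is regular in a nonzero ring; a lift of it to `Y` is then the
  -- non-nilpotent nonunit that excludes depth zero.
  have hx0 : ¬IsNilpotent (x 0) := by
    rintro ⟨k, hk⟩
    have h1 : (x 0 ^ k) • (1 : I.radical.subscheme.presheaf.stalk c) = (x 0 ^ k) • 0 := by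
      rw [hk, zero_smul, zero_smul]
    exact one_ne_zero ((hxr 0).pow k h1)
  have hxm : IsLocalRing.maximalIdeal _ = Ideal.span {x 0} := by
    rw [hx]
    congr 1
    ext z
    simp [eq_comm]
  obtain ⟨r, hr, hreg⟩ : ∃ r ∈ IsLocalRing.maximalIdeal (I.subscheme.presheaf.stalk (redIncl I c)),
      IsSMulRegular (I.subscheme.presheaf.stalk (redIncl I c)) r := by
    obtain ⟨w, hw⟩ := hφ (x 0)
    refine hCM.exists_isSMulRegular w ?_ fun h => hx0 (hw ▸ h.map _)
    rw [IsLocalRing.mem_maximalIdeal, mem_nonunits_iff]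
    intro h
    have h2 : x 0 ∈ IsLocalRing.maximalIdeal _ := hxm ▸ Ideal.mem_span_singleton_self _
    rw [IsLocalRing.mem_maximalIdeal, mem_nonunits_iff] at h2
    exact h2 (hw ▸ h.map _)
  obtain ⟨f, n, hn, hfk, hf⟩ := exists_isTrunc_of_isLocalRing ((redIncl I).stalkMap c).hom hφ
    (fun a ha => isNilpotent_of_stalkMap_eq_zero (redIncl I) redIncl_bijective.2 c ha)
    (x 0) hxm hx0 u v huv r hr hreg
  have := hX.finiteType
  have : IsLocallyNoetherian X := LocallyOfFiniteType.isLocallyNoetherian π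
  obtain ⟨_, ⟨U, hU, rfl⟩, hcU, -⟩ := X.isBasis_affineOpens.exists_subset_of_mem_open
    (Set.mem_univ (I.subschemeι (redIncl I c))) isOpen_univ
  have hV : IsAffineOpen (I.subschemeι ⁻¹ᵁ U) := hU.preimage _
  have : IsLocallyNoetherian I.subscheme := LocallyOfFiniteType.isLocallyNoetherian I.subschemeι
  have : IsNoetherianRing Γ(I.subscheme, I.subschemeι ⁻¹ᵁ U) :=
    IsLocallyNoetherian.component_noetherian ⟨_, hV⟩
  obtain ⟨g, hg, hfg⟩ := exists_isTrunc_basicOpen (redIncl I) hV c hcU hf hfk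
  -- The principal neighbourhood in `Y` is cut out by a function that extends to the ambient affine
  -- open, so it is the trace of an affine open of `X`.
  obtain ⟨g, rfl⟩ := I.subschemeι_app_surjective ⟨U, hU⟩ g
  refine ⟨n, hn, ⟨X.basicOpen g, hU.basicOpen g⟩, ?_, ?_⟩
  · rw [← Scheme.preimage_basicOpen] at hg
    rw [← hxy]
    exact hg
  · unfold HasParameter
    rw [Scheme.preimage_basicOpen]
    exact hfg

/-- Closed points suffice: `C` is quasi-compact, so every point specializes to a closed one and lies
in each of its neighbourhoods. The order is then a locally constant function on a connected space.
-/
theorem exists_hasParameter (hX : IsSmoothVariety π) (hI : IsPrimitiveMultipleCurve π I) :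
    ∃ n ≠ 0, ∀ c : I.radical.subscheme, ∃ U : X.affineOpens,
      I.radical.subschemeι c ∈ U.1 ∧ HasParameter I U n := by
  have := hX.quasiCompact
  have : CompactSpace I.radical.subscheme :=
    QuasiCompact.compactSpace_of_compactSpace (subStr π I.radical)
  have := hI.connected
  have h1 (c : I.radical.subscheme) : ∃ n ≠ 0, ∃ U : X.affineOpens,
      I.radical.subschemeι c ∈ U.1 ∧ HasParameter I U n := by
    obtain ⟨c', hc', hcl⟩ := (isClosed_closure (s := {c})).exists_closed_singleton
      ⟨c, subset_closure rfl⟩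
    obtain ⟨n, hn, U, hcU, hU⟩ := exists_hasParameter_of_isClosed hX hI hcl
    have h2 : c ⤳ c' := specializes_iff_mem_closure.mpr hc'
    exact ⟨n, hn, U, (h2.map I.radical.subschemeι.continuous).mem_open U.1.2 hcU, hU⟩
  choose n hn U hcU hU using h1
  have h2 : IsLocallyConstant n := by
    rw [IsLocallyConstant.iff_exists_open]
    exact fun c => ⟨I.radical.subschemeι ⁻¹ᵁ (U c).1, (I.radical.subschemeι ⁻¹ᵁ (U c).1).2, hcU c,
      fun c' hc' => (hU c').eq (hU c) (hcU c') hc'⟩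
  obtain ⟨c₀⟩ : Nonempty I.radical.subscheme := inferInstance
  refine ⟨n c₀, hn c₀, fun c => ⟨U c, hcU c, ?_⟩⟩
  rw [h2.apply_eq_of_preconnectedSpace c₀ c]
  exact hU c

/-- In each stalk of `Y` the ideal of `C` lands in `(F)`, so its `n`-th power lands in `(F^n) = 0`.
Conversely a parameter `f` lifts to the ideal of `C`; if the `k`-th power of that ideal lies in `I`,
then `f^k = 0` and `n ≤ k`. -/
theorem isMultiplicity_of_hasParameter [Nonempty I.radical.subscheme] {n : ℕ}
    (h : ∀ c : I.radical.subscheme, ∃ U : X.affineOpens,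
      I.radical.subschemeι c ∈ U.1 ∧ HasParameter I U n) : IsMultiplicity I n := by
  refine ⟨fun U s hs => ?_, fun k hk => ?_⟩
  · rw [Scheme.IdealSheafData.ideal_pow, Pi.pow_apply] at hs
    rw [← subschemeι_app_eq_zero_iff]
    refine eq_zero_of_forall_germ_eq_zero fun y hy => ?_
    obtain ⟨c, rfl⟩ := redIncl_bijective.2 y
    obtain ⟨V, hcV, hV⟩ := h c
    obtain ⟨F, hF, hk⟩ := hV.exists_stalk c hcV
    let φ : Γ(X, U.1) →+* I.subscheme.presheaf.stalk (redIncl I c) :=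
      (I.subscheme.presheaf.germ (I.subschemeι ⁻¹ᵁ U.1) (redIncl I c) hy).hom.comp
        (I.subschemeι.app U.1).hom
    have h1 : (I.radical.ideal U).map φ ≤ Ideal.span {F} := by
      rw [Ideal.map_le_iff_le_comap]
      intro t ht
      rw [Ideal.mem_comap, Ideal.mem_span_singleton, ← hk]
      change (redIncl I).stalkMap c (I.subscheme.presheaf.germ (I.subschemeι ⁻¹ᵁ U.1)
        (redIncl I c) hy (I.subschemeι.app U.1 t)) = 0
      rw [Scheme.Hom.germ_stalkMap_apply, (inclusion_app_eq_zero_iff I.le_radical U t).mpr ht,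
        map_zero]
    have h2 := Ideal.mem_map_of_mem φ hs
    rw [Ideal.map_pow] at h2
    have h3 := Ideal.pow_right_mono h1 n h2
    rw [Ideal.span_singleton_pow, hF.pow_eq_zero, Ideal.mem_span_singleton, zero_dvd_iff] at h3
    exact h3
  · obtain ⟨c⟩ := ‹Nonempty I.radical.subscheme›
    obtain ⟨U, hcU, f, hf, hfk⟩ := h c
    obtain ⟨t, rfl⟩ := I.subschemeι_app_surjective U f
    have h1 : t ∈ I.radical.ideal U :=
      (inclusion_app_eq_zero_iff I.le_radical U t).mp ((hfk _).mpr dvd_rfl)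
    refine hf.le_of_pow_eq_zero
      (not_isUnit_of_app_eq_zero (redIncl I) (mem_of_redIncl hcU) ((hfk _).mpr dvd_rfl)) ?_
    rw [← map_pow, subschemeι_app_eq_zero_iff]
    refine hk U ?_
    rw [Scheme.IdealSheafData.ideal_pow, Pi.pow_apply]
    exact Ideal.pow_mem_pow h1 k

theorem isAbstractPrimitiveCurve_of_isPrimitiveMultipleCurve (hX : IsSmoothVariety π)
    (hI : IsPrimitiveMultipleCurve π I) :
    ∃ (n : ℕ) (_ : NeZero n), IsMultiplicity I n ∧
      IsAbstractPrimitiveCurve (subStr π I) (redIncl I) n := by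
  obtain ⟨n, hn, h⟩ := exists_hasParameter hX hI
  have := hI.connected
  have : NeZero n := ⟨hn⟩
  refine ⟨n, this, isMultiplicity_of_hasParameter h,
    isAbstractPrimitiveCurve_of_charts n redIncl_bijective fun c => ?_⟩
  obtain ⟨U, hcU, f, hf, hk⟩ := h c
  have : Smooth (redIncl I ≫ subStr π I) := by
    rw [redIncl_subStr]
    have := hI.smooth
    exact SmoothOfRelativeDimension.smooth 1 _
  have hV : IsAffineOpen (I.subschemeι ⁻¹ᵁ U.1) := U.2.preimage _
  exact ⟨_, mem_of_redIncl hcU, exists_chart (subStr π I) (redIncl I) hV (hV.preimage _)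
    ((redIncl I).app_surjective _ hV) hf hk⟩

end Reduced

end PrimitiveCurves

end

theorem mainTheorem3 :
    (∀ (X : Scheme.{0}) (π : X ⟶ SpecC), IsSmoothVariety π → IrreducibleSpace X →
      ∀ I : X.IdealSheafData, IsSmoothHypersurface π I →
      ∀ (n : ℕ) [NeZero n] (P : I.subscheme),
        (∃ σ : LocalRingAt (subStr π I) P →ₐ[ℂ] LocalRingAt (subStr π (I ^ n)) (thickIncl I n P),
          ∀ a, restriction π I n P (σ a) = a) ∧
        (∀ σ : LocalRingAt (subStr π I) P →ₐ[ℂ] LocalRingAt (subStr π (I ^ n)) (thickIncl I n P),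
          (∀ a, restriction π I n P (σ a) = a) →
          ∃ e : (LocalRingAt (subStr π I) P ⊗[ℂ] TruncPoly n) ≃ₐ[ℂ]
              LocalRingAt (subStr π (I ^ n)) (thickIncl I n P),
            (∀ a, e (a ⊗ₜ 1) = σ a) ∧ restriction π I n P (e (1 ⊗ₜ TruncPoly.t n)) = 0) ∧
        (∃ V : (I ^ n).subscheme.Opens, thickIncl I n P ∈ V ∧
          ∃ e : V.toScheme ≅ prodZ ((thickIncl I n ⁻¹ᵁ V).ι ≫ subStr π I) n,
            e.hom ≫ prodZ.str _ n = V.ι ≫ subStr π (I ^ n) ∧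
            (thickIncl I n ∣_ V) ≫ e.hom = prodZ.zero _ n)) ∧
    (∀ (X : Scheme.{0}) (π : X ⟶ SpecC), IsSmoothVariety π → SmoothOfRelativeDimension 3 π →
      ConnectedSpace X → ∀ I : X.IdealSheafData, IsPrimitiveMultipleCurve π I →
      ∃ (n : ℕ) (_ : NeZero n), IsMultiplicity I n ∧
        IsAbstractPrimitiveCurve (subStr π I)
          (Scheme.IdealSheafData.inclusion I.le_radical) n) :=
  ⟨fun _ _ _ _ _ hI n _ P => hypersurface_thickening hI n P,
    fun _ _ hX _ _ _ hI => isAbstractPrimitiveCurve_of_isPrimitiveMultipleCurve hX hI⟩
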